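/- Let $a<b$, $\alpha\in\mathbb R$, let $r\ge 1$ be an integer, and let $k:[a,b]\times[a,b]\to\mathbb C$ be of class $C^r$. On the complex Banach space $X=L^\infty[a,b]$ consider the bounded operator $$\mathcal A f(x)=\alpha\int_a^b k(x,u)f(u)\,du-x^2f(x).$$ For a partition $a=x_0<x_1<\dots<x_n=b$ put $I_j=[x_{j-1},x_j]$ and $h=\max_j(x_j-x_{j-1})$, and let $f_j:[-1,1]\to I_j$, $f_j(t)=\frac{1-t}{2}x_{j-1}+\frac{1+t}{2}x_j$. Let $\tau_1,\dots,\tau_r$ be the zeros in $[-1,1]$ of the Legendre polynomial $\frac{d^r}{dt^r}(t^2-1)^r$, let $\ell_1,\dots,\ell_r$ be the Lagrange polynomials with $\ell_i(\tau_j)=\delta_{ij}$, and put $\xi_{ij}=f_j(\tau_i)$, $\phi_{ij}=\ell_i\circ f_j^{-1}$ on $I_j$ and $\phi_{ij}=0$ elsewhere. With $N_h=nr$, enumerate the $\xi_{ij}$ as $t_1,\dots,t_{N_h}$ and the $\phi_{ij}$ correspondingly as $\psi_1,\dots,\psi_{N_h}$, and define $$k_{N_h}(x,u)=\sum_{p=1}^{N_h}\sum_{q=1}^{N_h}k(t_p,t_q)\,\psi_p(x)\,\psi_q(u),\qquad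 s_{N_h}(x)=\Big(\frac{x_{j-1}+x_j}{2}\Big)^2\ \text{ for } x\in I_j,\ 1\le j\le n$$ (the values at the partition points are immaterial), and the bounded operator on $X$ $$\mathcal A_{N_h}f(x)=\alpha\int_a^b k_{N_h}(x,u)f(u)\,du-s_{N_h}(x)f(x).$$ Then: 1. There is a constant $C$, independent of the partition, such that $\|\mathcal A-\mathcal A_{N_h}\|\le C\,h$ for every partition. 2. Let $\lambda$ be an isolated point of $\sigma(\mathcal A)$ (in particular, any isolated eigenvalue), let $0<\epsilon<\operatorname{dist}(\lambda,\sigma(\mathcal A)\setminus\{\lambda\})$, and take any sequence of partitions with $h\to0$. Then for all sufficiently large indices in the sequence, $\mathcal A_{N_h}$ has an eigenvalue $\lambda_{N_h}$ with $|\lambda_{N_h}-\lambda|<\epsilon$; and every sequence of points $\lambda_{N_h}\in\sigma(\mathcal A_{N_h})$ that satisfies $|\lambda_{N_h}-\lambda|<\epsilon$ for all large indices converges to $\lambda$. 3. Let $\lambda$ moreover be a simple eigenvalue of $\mathcal A$, i.e. an eigenvalue for which $\ker(\mathcal A-\lambda I)^l$ has dimension one, where $l$ is the least positive integer with $\ker(\mathcal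 A-\lambda I)^l=\ker(\mathcal A-\lambda I)^{l+1}$. Then there are constants $c$ and $C'$ such that, for every sequence of partitions with $h\to 0$ and every $\epsilon$ as in 2, for all sufficiently large indices every $\lambda_{N_h}\in\sigma(\mathcal A_{N_h})$ with $|\lambda_{N_h}-\lambda|<\epsilon$ satisfies $$|\lambda_{N_h}-\lambda|\le c\,\|\mathcal A_{N_h}-\mathcal A\|\qquad\text{and}\qquad|\lambda_{N_h}-\lambda|\le C'\,h.$$ -/

import Mathlib

open MeasureTheory Set Filter Topology
open scoped ENNReal

noncomputable section

namespace DegenerateKernel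

/-! ### The Banach space and the two kinds of operators -/

/-- Lebesgue measure on the interval `[a, b]`. -/
abbrev intervalMeasure (a b : ℝ) : Measure ℝ := volume.restrict (Icc a b)

/-- The complex Banach space `L^∞[a, b]`. -/
abbrev LInf (a b : ℝ) : Type := Lp ℂ ∞ (intervalMeasure a b)

/-- A measurable and bounded kernel on the square `[a, b] × [a, b]`. -/
def IsBddKernel (a b : ℝ) (κ : ℝ → ℝ → ℂ) : Prop :=
  AEStronglyMeasurable (Function.uncurry κ) ((intervalMeasure a b).prod (intervalMeasure a b)) ∧
    ∃ C : ℝ, ∀ x ∈ Icc a b, ∀ u ∈ Icc a b, ‖κ x u‖ ≤ C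

theorem isBddKernel_of_continuousOn {a b : ℝ} {k : ℝ → ℝ → ℂ}
    (hk : ContinuousOn (Function.uncurry k) (Icc a b ×ˢ Icc a b)) : IsBddKernel a b k := by
  refine ⟨?_, ?_⟩
  · rw [Measure.prod_restrict]
    exact hk.aestronglyMeasurable (measurableSet_Icc.prod measurableSet_Icc)
  · obtain ⟨C, hC⟩ := (isCompact_Icc.prod isCompact_Icc).exists_bound_of_continuousOn hk
    exact ⟨C, fun x hx u hu => hC (x, u) ⟨hx, hu⟩⟩

theorem ae_norm_le {a b : ℝ} (f : LInf a b) : ∀ᵐ u ∂(intervalMeasure a b), ‖f u‖ ≤ ‖f‖ := by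
  filter_upwards [ae_le_eLpNormEssSup (f := f) (μ := intervalMeasure a b)] with u hu
  rw [← eLpNorm_exponent_top, ← Lp.enorm_def] at hu
  exact enorm_le_iff_norm_le.mp hu

theorem integrand_memLp {a b : ℝ} {κ : ℝ → ℝ → ℂ} (hκ : IsBddKernel a b κ) (f : LInf a b) :
    MemLp (fun x => ∫ u in Icc a b, κ x u * f u) ∞ (intervalMeasure a b) := by
  obtain ⟨hm, C, hC⟩ := hκ
  refine memLp_top_of_bound ?_ ((|C| * ‖f‖) * (intervalMeasure a b).real univ) ?_
  · exact (hm.mul (Lp.aestronglyMeasurable f).comp_snd).integral_prod_right'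
  · filter_upwards [ae_restrict_mem measurableSet_Icc] with x hx
    refine norm_integral_le_of_norm_le_const ?_
    filter_upwards [ae_restrict_mem measurableSet_Icc, ae_norm_le f] with u hu hf
    rw [norm_mul]
    exact mul_le_mul ((hC x hx u hu).trans (le_abs_self C)) hf (norm_nonneg _) (abs_nonneg _)

theorem integrand_integrable {a b : ℝ} {κ : ℝ → ℝ → ℂ} (hκ : IsBddKernel a b κ) (f : LInf a b) :
    ∀ᵐ x ∂(intervalMeasure a b),
      Integrable (fun u => κ x u * f u) (intervalMeasure a b) := by
  obtain ⟨hm, C, hC⟩ := hκ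
  have h1 := (hm.mul (Lp.aestronglyMeasurable f).comp_snd).prodMk_left
  filter_upwards [h1, ae_restrict_mem measurableSet_Icc] with x h1 hx
  refine Integrable.of_bound h1 (|C| * ‖f‖) ?_
  filter_upwards [ae_restrict_mem measurableSet_Icc, ae_norm_le f] with u hu hf
  rw [norm_mul]
  exact mul_le_mul ((hC x hx u hu).trans (le_abs_self C)) hf (norm_nonneg _) (abs_nonneg _)

/-- The linear map `f ↦ (x ↦ ∫ₐᵇ κ(x, u) f(u) du)` on `L^∞[a, b]`. -/
def integralLinearMap {a b : ℝ} {κ : ℝ → ℝ → ℂ} (hκ : IsBddKernel a b κ) :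
    LInf a b →ₗ[ℂ] LInf a b where
  toFun f := (integrand_memLp hκ f).toLp (fun x => ∫ u in Icc a b, κ x u * f u)
  map_add' f g := by
    rw [← MemLp.toLp_add, MemLp.toLp_eq_toLp_iff]
    filter_upwards [integrand_integrable hκ f, integrand_integrable hκ g] with x hf hg
    rw [Pi.add_apply, ← integral_add hf hg]
    refine integral_congr_ae ?_
    filter_upwards [Lp.coeFn_add f g] with u hu
    rw [hu, Pi.add_apply, mul_add]
  map_smul' c f := by
    rw [RingHom.id_apply, ← MemLp.toLp_const_smul, MemLp.toLp_eq_toLp_iff]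
    refine Eventually.of_forall fun x => ?_
    rw [Pi.smul_apply, ← integral_smul]
    refine integral_congr_ae ?_
    filter_upwards [Lp.coeFn_smul c f] with u hu
    rw [hu, Pi.smul_apply, smul_eq_mul, smul_eq_mul, mul_left_comm]

theorem integralLinearMap_bound {a b : ℝ} {κ : ℝ → ℝ → ℂ} (hκ : IsBddKernel a b κ) :
    ∃ C : ℝ, ∀ f : LInf a b, ‖integralLinearMap hκ f‖ ≤ C * ‖f‖ := by
  obtain ⟨C, hC⟩ := hκ.2
  refine ⟨|C| * (intervalMeasure a b).real univ, fun f => ?_⟩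
  have hb : ∀ᵐ x ∂(intervalMeasure a b), ‖integralLinearMap hκ f x‖ ≤
      (|C| * ‖f‖) * (intervalMeasure a b).real univ := by
    filter_upwards [MemLp.coeFn_toLp (integrand_memLp hκ f),
      ae_restrict_mem measurableSet_Icc] with x hx hxI
    change ‖(integrand_memLp hκ f).toLp _ x‖ ≤ _
    rw [hx]
    refine norm_integral_le_of_norm_le_const ?_
    filter_upwards [ae_restrict_mem measurableSet_Icc, ae_norm_le f] with u hu hf
    rw [norm_mul]
    exact mul_le_mul ((hC x hxI u hu).trans (le_abs_self C)) hf (norm_nonneg _) (abs_nonneg _)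
  have h := Lp.norm_le_of_ae_bound (by positivity) hb
  simp only [ENNReal.toReal_top, inv_zero, Real.rpow_zero, one_mul] at h
  calc ‖integralLinearMap hκ f‖ ≤ _ := h
    _ = _ := by ring

/-- The bounded integral operator `f ↦ (x ↦ ∫ₐᵇ κ(x, u) f(u) du)` on `L^∞[a, b]`. -/
def integralOp {a b : ℝ} {κ : ℝ → ℝ → ℂ} (hκ : IsBddKernel a b κ) :
    LInf a b →L[ℂ] LInf a b :=
  (integralLinearMap hκ).mkContinuousOfExistsBound (integralLinearMap_bound hκ)

/-- The bounded multiplication operator `f ↦ m f` on `L^∞[a, b]`, for `m` in `L^∞[a, b]`. -/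
def multOp {a b : ℝ} {m : ℝ → ℂ} (hm : MemLp m ∞ (intervalMeasure a b)) :
    LInf a b →L[ℂ] LInf a b :=
  (ContinuousLinearMap.mul ℂ ℂ).holderL (intervalMeasure a b) ∞ ∞ ∞ (hm.toLp m)

/-! ### The operator `A` -/

/-- The function `x ↦ x²`, complex valued. -/
def sqFun (x : ℝ) : ℂ := ((x ^ 2 : ℝ) : ℂ)

theorem sqFun_memLp (a b : ℝ) : MemLp sqFun ∞ (intervalMeasure a b) := by
  have hc : Continuous sqFun := Complex.continuous_ofReal.comp (continuous_id.pow 2)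
  obtain ⟨C, hC⟩ := (isCompact_Icc (a := a) (b := b)).exists_bound_of_continuousOn hc.continuousOn
  refine memLp_top_of_bound hc.aestronglyMeasurable C ?_
  filter_upwards [ae_restrict_mem measurableSet_Icc] with x hx
  exact hC x hx

/-- `A f(x) = α ∫ₐᵇ k(x, u) f(u) du - x² f(x)`, for a kernel continuous on `[a, b] × [a, b]`. -/
def opA {a b : ℝ} (α : ℝ) {k : ℝ → ℝ → ℂ}
    (hk : ContinuousOn (Function.uncurry k) (Icc a b ×ˢ Icc a b)) : LInf a b →L[ℂ] LInf a b :=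
  (α : ℂ) • integralOp (isBddKernel_of_continuousOn hk) - multOp (sqFun_memLp a b)

/-! ### Partitions, Gauss points and the interpolatory basis functions -/

/-- A partition `a = x₀ < x₁ < ⋯ < xₙ = b`. -/
structure Partition (a b : ℝ) where
  /-- the number of subintervals -/
  n : ℕ
  /-- the partition points -/
  node : Fin (n + 1) → ℝ
  strictMono : StrictMono node
  first : node 0 = a
  last : node (Fin.last n) = b

/-- The left endpoint of the `j`-th subinterval. -/
def Partition.left {a b : ℝ} (P : Partition a b) (j : Fin P.n) : ℝ := P.node j.castSucc

/-- The right endpoint of the `j`-th subinterval. -/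
def Partition.right {a b : ℝ} (P : Partition a b) (j : Fin P.n) : ℝ := P.node j.succ

/-- The norm `h` of the partition: the largest length of a subinterval. -/
def Partition.mesh {a b : ℝ} (P : Partition a b) : ℝ := ⨆ j : Fin P.n, (P.right j - P.left j)

/-- The Legendre polynomial (up to normalization) `dʳ/dtʳ (t² - 1)ʳ`. -/
def legendrePoly (r : ℕ) : Polynomial ℝ :=
  Polynomial.derivative^[r] ((Polynomial.X ^ 2 - 1) ^ r)

/-- The set `B_r` of Gauss points: the zeros of the Legendre polynomial in `[-1, 1]`. -/
def gaussPoints (r : ℕ) : Finset ℝ :=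
  (legendrePoly r).roots.toFinset.filter (fun t => -1 ≤ t ∧ t ≤ 1)

/-- The affine map `f_j` of `[-1, 1]` onto the `j`-th subinterval. -/
def Partition.refMap {a b : ℝ} (P : Partition a b) (j : Fin P.n) (t : ℝ) : ℝ :=
  (1 - t) / 2 * P.left j + (1 + t) / 2 * P.right j

/-- The inverse of the affine map `f_j`. -/
def Partition.refInv {a b : ℝ} (P : Partition a b) (j : Fin P.n) (x : ℝ) : ℝ :=
  (2 * x - P.left j - P.right j) / (P.right j - P.left j)

/-- The index set of the `N_h = n r` Gauss points on `[a, b]`: a subinterval and a point of `B_r`. -/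
abbrev Partition.Index {a b : ℝ} (P : Partition a b) (r : ℕ) : Type :=
  Fin P.n × {τ : ℝ // τ ∈ gaussPoints r}

/-- The Gauss points `ξ = f_j(τ)` on `[a, b]`. -/
def Partition.gaussNode {a b : ℝ} (P : Partition a b) {r : ℕ} (i : P.Index r) : ℝ :=
  P.refMap i.1 i.2

/-- The basis function that equals `ℓ_τ ∘ f_j⁻¹` on the `j`-th closed subinterval, and `0` elsewhere,
where `ℓ_τ` is the Lagrange polynomial of the point `τ` of `B_r`. -/
def Partition.basisFun {a b : ℝ} (P : Partition a b) {r : ℕ} (i : P.Index r) : ℝ → ℝ :=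
  (Icc (P.left i.1) (P.right i.1)).indicator
    (fun x => (Lagrange.basis (gaussPoints r) id (i.2 : ℝ)).eval (P.refInv i.1 x))

/-- The degenerate kernel `∑ᵢ ∑ⱼ k(tᵢ, tⱼ) ψᵢ(x) ψⱼ(u)`. -/
def Partition.degKernel {a b : ℝ} (P : Partition a b) (r : ℕ) (k : ℝ → ℝ → ℂ) (x u : ℝ) : ℂ :=
  ∑ i : P.Index r, ∑ j : P.Index r,
    k (P.gaussNode i) (P.gaussNode j) * (P.basisFun i x : ℂ) * (P.basisFun j u : ℂ)

/-- The piecewise constant function with value `((x_{j-1} + x_j) / 2)²` on the `j`-th subinterval.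
Its values at the partition points, a null set, do not matter. -/
def Partition.stepFun {a b : ℝ} (P : Partition a b) (x : ℝ) : ℂ :=
  ∑ j : Fin P.n, (Ioc (P.left j) (P.right j)).indicator
    (fun _ => ((((P.left j + P.right j) / 2) ^ 2 : ℝ) : ℂ)) x

theorem Partition.continuous_basisPoly {a b : ℝ} (P : Partition a b) {r : ℕ} (i : P.Index r) :
    Continuous
      (fun x => (Lagrange.basis (gaussPoints r) id (i.2 : ℝ)).eval (P.refInv i.1 x)) := by
  unfold Partition.refInv
  exact (Polynomial.continuous _).comp (by fun_prop)

theorem Partition.measurable_basisFun {a b : ℝ} (P : Partition a b) {r : ℕ} (i : P.Index r) :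
    Measurable (P.basisFun i) :=
  (P.continuous_basisPoly i).measurable.indicator measurableSet_Icc

theorem Partition.basisFun_bound {a b : ℝ} (P : Partition a b) {r : ℕ} (i : P.Index r) :
    ∃ C : ℝ, ∀ x, ‖P.basisFun i x‖ ≤ C := by
  obtain ⟨C, hC⟩ := (isCompact_Icc (a := P.left i.1) (b := P.right i.1)).exists_bound_of_continuousOn
    (P.continuous_basisPoly i).continuousOn
  refine ⟨|C|, fun x => ?_⟩
  by_cases hx : x ∈ Icc (P.left i.1) (P.right i.1)
  · rw [Partition.basisFun, indicator_of_mem hx]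
    exact (hC x hx).trans (le_abs_self C)
  · rw [Partition.basisFun, indicator_of_notMem hx, norm_zero]
    exact abs_nonneg C

theorem Partition.degKernel_isBddKernel {a b : ℝ} (P : Partition a b) (r : ℕ) (k : ℝ → ℝ → ℂ) :
    IsBddKernel a b (P.degKernel r k) := by
  refine ⟨Measurable.aestronglyMeasurable ?_, ?_⟩
  · have hm := fun i : P.Index r => P.measurable_basisFun i
    unfold Function.uncurry Partition.degKernel
    fun_prop
  · choose C hC using fun i : P.Index r => P.basisFun_bound i
    refine ⟨∑ i : P.Index r, ∑ j : P.Index r,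
      ‖k (P.gaussNode i) (P.gaussNode j)‖ * C i * C j, fun x _ u _ => ?_⟩
    refine (norm_sum_le _ _).trans (Finset.sum_le_sum fun i _ => ?_)
    refine (norm_sum_le _ _).trans (Finset.sum_le_sum fun j _ => ?_)
    rw [norm_mul, norm_mul, Complex.norm_real, Complex.norm_real]
    have h0 : 0 ≤ C i := (norm_nonneg _).trans (hC i x)
    gcongr
    · exact hC i x
    · exact hC j u

theorem Partition.stepFun_memLp {a b : ℝ} (P : Partition a b) :
    MemLp P.stepFun ∞ (intervalMeasure a b) := by
  unfold Partition.stepFun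
  exact memLp_finsetSum _ fun j _ => (memLp_const _).indicator measurableSet_Ioc

/-- The approximating operator
`A_{N_h} f(x) = α ∫ₐᵇ k_{N_h}(x, u) f(u) du - s_{N_h}(x) f(x)`. -/
def opApprox {a b : ℝ} (α : ℝ) (k : ℝ → ℝ → ℂ) (r : ℕ) (P : Partition a b) :
    LInf a b →L[ℂ] LInf a b :=
  (α : ℂ) • integralOp (P.degKernel_isBddKernel r k) - multOp P.stepFun_memLp

/-! ### Spectral notions -/

/-- `z` is an isolated point of the set `S`. -/
def IsIsolatedPoint (S : Set ℂ) (z : ℂ) : Prop :=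
  z ∈ S ∧ ∃ δ : ℝ, 0 < δ ∧ ∀ w ∈ S, ‖w - z‖ < δ → w = z

/-- `z` is an eigenvalue of the bounded operator `T`. -/
def IsEigenvalue {a b : ℝ} (T : LInf a b →L[ℂ] LInf a b) (z : ℂ) : Prop :=
  Module.End.HasEigenvalue (T : Module.End ℂ (LInf a b)) z

/-- `ker (T - z)ˡ`. -/
def kerPow {a b : ℝ} (T : LInf a b →L[ℂ] LInf a b) (z : ℂ) (l : ℕ) : Submodule ℂ (LInf a b) :=
  LinearMap.ker (((T : Module.End ℂ (LInf a b)) - z • 1) ^ l)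

/-- `l` is the ascent of `z`: the least positive integer with `ker (T - z)ˡ = ker (T - z)ˡ⁺¹`. -/
def IsAscent {a b : ℝ} (T : LInf a b →L[ℂ] LInf a b) (z : ℂ) (l : ℕ) : Prop :=
  IsLeast {m : ℕ | 0 < m ∧ kerPow T z m = kerPow T z (m + 1)} l

/-- `z` is a simple eigenvalue of `T`: the algebraic multiplicity, the dimension of `ker (T - z)ˡ`
with `l` the ascent of `z`, is one. -/
def IsSimpleEigenvalue {a b : ℝ} (T : LInf a b →L[ℂ] LInf a b) (z : ℂ) : Prop :=
  IsEigenvalue T z ∧ ∃ l : ℕ, IsAscent T z l ∧ Module.finrank ℂ (kerPow T z l) = 1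

end DegenerateKernel

end

/-! Everything follows from norm convergence at rate `h`. The kernel `k` is Lipschitz, and the
Lagrange polynomials sum to 1 and are bounded on `[-1, 1]` independently of the partition, so the
kernel error is `O(h)` (`norm_sub_degKernel_le`); replacing `x²` by its midpoint values also costs
`O(h)`. Exactness of interpolation on constants is enough.

An isolated spectral point survives small perturbations (`eventually_exists_mem_spectrum`):
resolvents of nearby operators are uniformly bounded on a surrounding circle. Were there no spectrum
inside, the maximum principle would carry this bound to the centre, and a Neumann series would put
the centre in the resolvent set of the limit. Compact sets in the resolvent set stay there under
perturbation, so nearby spectral points can only accumulate at the isolated point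
(`eventually_norm_sub_lt`).

Spectral points of the approximants are eigenvalues (`exists_eigenfunction_opApprox`). Off the
values of `-s`, the Fredholm alternative applies to a finite-rank perturbation of an invertible
multiplication; at such a value, some nonzero polynomial on one subinterval is killed by the
finite-rank part.

For the rate, all values of `-x²` lie in the spectrum and none is isolated, so at an isolated `λ`
the operator `A - λ` is invertible plus finite rank (`exists_isUnit_add_finiteRank`). If `λ` is
simple, a rank-one bordering makes `A - λ` invertible and yields a functional that annihilates its
range but not the eigenvector. Applying it to the perturbed eigenvalue equation gives the linear
bound (`exists_norm_eigenvalue_le`). -/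

namespace DegenerateKernel

/-! ### Spectra in Banach algebras under small perturbations -/

section Perturbation

variable {R : Type*} [NormedRing R] [NormedAlgebra ℂ R] [CompleteSpace R]

/-- Openness of the units, jointly in the element and the scalar, so that compactness in the scalar
gives uniform statements. -/
theorem eventually_isUnit_sub {x : R} {z : ℂ} (hz : z ∉ spectrum ℂ x) :
    ∀ᶠ p : R × ℂ in 𝓝 (x, z), IsUnit (algebraMap ℂ R p.2 - p.1) := by
  have hc : ContinuousAt (fun p : R × ℂ => algebraMap ℂ R p.2 - p.1) (x, z) := by
    have := (continuous_algebraMap ℂ R)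
    fun_prop
  exact hc.eventually (Units.isOpen.mem_nhds (spectrum.notMem_iff.mp hz))

theorem eventually_disjoint_spectrum {x : R} {K : Set ℂ} (hK : IsCompact K)
    (hd : ∀ z ∈ K, z ∉ spectrum ℂ x) :
    ∀ᶠ y in 𝓝 x, ∀ z ∈ K, z ∉ spectrum ℂ y := by
  refine hK.eventually_forall_of_forall_eventually fun z hz => ?_
  filter_upwards [eventually_isUnit_sub (hd z hz)] with p hp
  exact spectrum.notMem_iff.mpr hp

theorem exists_eventually_norm_resolvent_le {x : R} {K : Set ℂ} (hK : IsCompact K)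
    (hd : ∀ z ∈ K, z ∉ spectrum ℂ x) :
    ∃ M : ℝ, ∀ᶠ y in 𝓝 x, ∀ z ∈ K, ‖resolvent y z‖ ≤ M := by
  have hcont : ∀ z ∈ K, ContinuousAt (fun p : R × ℂ => resolvent p.1 p.2) (x, z) := by
    intro z hz
    obtain ⟨u, hu⟩ := spectrum.notMem_iff.mp (hd z hz)
    have hc : ContinuousAt (fun p : R × ℂ => algebraMap ℂ R p.2 - p.1) (x, z) := by
      have := (continuous_algebraMap ℂ R)
      fun_prop
    have hi := NormedRing.inverse_continuousAt u
    rw [hu] at hi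
    exact ContinuousAt.comp (f := fun p : R × ℂ => algebraMap ℂ R p.2 - p.1) hi hc
  have hK' : ContinuousOn (fun z : ℂ => resolvent x z) K := fun z hz =>
    (ContinuousAt.comp (f := fun z : ℂ => (x, z)) (hcont z hz)
      (by fun_prop)).continuousWithinAt
  obtain ⟨M, hM⟩ := hK.exists_bound_of_continuousOn hK'
  refine ⟨M + 1, hK.eventually_forall_of_forall_eventually fun z hz => ?_⟩
  filter_upwards [(hcont z hz).norm.eventually
    (Iio_mem_nhds ((hM z hz).trans_lt (lt_add_one M)))] with p hp
  exact (mem_Iio.mp hp).le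

/-- A spectral point surrounded by a circle in the resolvent set persists inside the circle. -/
theorem eventually_exists_mem_spectrum {x : R} {lam : ℂ} (hlam : lam ∈ spectrum ℂ x) {δ : ℝ}
    (hδ : 0 < δ) (hd : ∀ z ∈ Metric.sphere lam δ, z ∉ spectrum ℂ x) :
    ∀ᶠ y in 𝓝 x, ∃ z ∈ spectrum ℂ y, ‖z - lam‖ < δ := by
  obtain ⟨M, hM⟩ := exists_eventually_norm_resolvent_le (isCompact_sphere lam δ) hd
  have hclose : ∀ᶠ y in 𝓝 x, ‖x - y‖ * (|M| + 1) < 1 := by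
    have hc : Continuous fun y : R => ‖x - y‖ * (|M| + 1) := by fun_prop
    refine hc.continuousAt.eventually (Iio_mem_nhds ?_)
    simp
  filter_upwards [hM, hclose, eventually_disjoint_spectrum (isCompact_sphere lam δ) hd]
    with y hy hxy hsph
  by_contra! hcon
  -- The interior is covered by the contradiction hypothesis, the boundary circle by `hsph`.
  have hres : ∀ z ∈ Metric.closedBall lam δ, z ∈ resolventSet ℂ y := by
    intro z hz
    by_contra h
    have h1 := hcon z h
    rw [mem_closedBall_iff_norm] at hz
    exact hsph z (mem_sphere_iff_norm.mpr (le_antisymm hz h1)) h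
  have hcl : closure (Metric.ball lam δ) = Metric.closedBall lam δ := closure_ball _ hδ.ne'
  have hfr : frontier (Metric.ball lam δ) = Metric.sphere lam δ := frontier_ball _ hδ.ne'
  have hdiff : DiffContOnCl ℂ (resolvent y) (Metric.ball lam δ) := by
    refine DifferentiableOn.diffContOnCl ?_
    rw [hcl]
    intro z hz
    exact (spectrum.hasDerivAt_resolvent_const_left (hres z hz)).differentiableAt.differentiableWithinAt
  -- Maximum modulus principle for the operator-valued resolvent of `y`.
  have hbd : ‖resolvent y lam‖ ≤ M := by
    refine Complex.norm_le_of_forall_mem_frontier_norm_le Metric.isBounded_ball hdiff ?_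
      (subset_closure (Metric.mem_ball_self hδ))
    rw [hfr]
    exact hy
  obtain ⟨u, hu⟩ := hres lam (Metric.mem_closedBall_self hδ.le)
  have hinv : resolvent y lam = ↑u⁻¹ := by
    rw [resolvent, ← hu, Ring.inverse_unit]
  refine hlam ?_
  have hsmall : ‖(↑u⁻¹ : R) * (x - y)‖ < 1 := by
    rw [← hinv]
    calc ‖resolvent y lam * (x - y)‖ ≤ ‖resolvent y lam‖ * ‖x - y‖ := norm_mul_le _ _
      _ ≤ (|M| + 1) * ‖x - y‖ := by
        gcongr
        exact (hbd.trans (le_abs_self M)).trans (by simp)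
      _ < 1 := by rwa [mul_comm]
  have h1 : IsUnit (1 - (↑u⁻¹ : R) * (x - y)) := isUnit_one_sub_of_norm_lt_one hsmall
  -- With `u = lam - y`, the perturbation `x - y` is absorbed by a Neumann series.
  have h2 : algebraMap ℂ R lam - x = ↑u * (1 - (↑u⁻¹ : R) * (x - y)) := by
    rw [mul_sub, mul_one, Units.mul_inv_cancel_left, hu]
    abel
  rw [spectrum.mem_resolventSet_iff, h2]
  exact u.isUnit.mul h1

end Perturbation

/-! ### Finite-rank perturbations of invertible operators -/

section FiniteRank

variable {X : Type*} [NormedAddCommGroup X] [NormedSpace ℂ X] [CompleteSpace X]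

/-- The Fredholm alternative for finite-rank perturbations of the identity. -/
theorem surjective_add_of_finiteDimensional_range {V : Type*} [AddCommGroup V] [Module ℂ V]
    (F : V →ₗ[ℂ] V) [FiniteDimensional ℂ (LinearMap.range F)]
    (hinj : ∀ x, x + F x = 0 → x = 0) (y : V) : ∃ x, x + F x = y := by
  -- The range of `F` is invariant under `1 + F`, where injectivity implies surjectivity. Solving `w
  -- + F w = F y` there makes `y - w` a preimage of `y`.
  let W := LinearMap.range F
  let g : W →ₗ[ℂ] W := LinearMap.id + F.rangeRestrict.comp W.subtype
  have hg : Function.Injective g := by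
    rw [injective_iff_map_eq_zero]
    intro w hw
    have := congrArg Subtype.val hw
    exact Subtype.ext (hinj w this)
  obtain ⟨w, hw⟩ := (LinearMap.injective_iff_surjective.mp hg) (F.rangeRestrict y)
  have hw' : (w : V) + F w = F y := congrArg Subtype.val hw
  refine ⟨y - w, ?_⟩
  rw [map_sub, ← hw']
  abel

/-- Factor `S + F = S (1 + S⁻¹ F)`, where `S⁻¹ F` again has finite rank; a bounded bijection of a
Banach space is a unit. -/
theorem isUnit_add_of_finiteDimensional_range {S F : X →L[ℂ] X} (hS : IsUnit S)
    (hF : FiniteDimensional ℂ (LinearMap.range (F : X →ₗ[ℂ] X)))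
    (hinj : ∀ x, (S + F) x = 0 → x = 0) : IsUnit (S + F) := by
  have hSb := ContinuousLinearMap.isUnit_iff_bijective.mp hS
  refine ContinuousLinearMap.isUnit_iff_bijective.mpr
    ⟨(injective_iff_map_eq_zero _).mpr hinj, fun y => ?_⟩
  obtain ⟨u, rfl⟩ := hS
  have hmul : ∀ x, (u : X →L[ℂ] X) ((↑u⁻¹ : X →L[ℂ] X) x) = x := fun x => by
    rw [← mul_apply_eq_comp, Units.mul_inv, one_apply_eq_self]
  let F' : X →ₗ[ℂ] X := ((↑u⁻¹ : X →L[ℂ] X) : X →ₗ[ℂ] X).comp (F : X →ₗ[ℂ] X)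
  have : FiniteDimensional ℂ (LinearMap.range F') := by
    rw [LinearMap.range_comp]
    infer_instance
  have hu : ∀ x, ((u : X →L[ℂ] X) + F) x = (u : X →L[ℂ] X) (x + F' x) := fun x => by
    rw [map_add]
    change _ = _ + (u : X →L[ℂ] X) ((↑u⁻¹ : X →L[ℂ] X) (F x))
    rw [hmul]
    rfl
  obtain ⟨x, hx⟩ := surjective_add_of_finiteDimensional_range F'
    (fun x hx => hinj x (by rw [hu, hx, map_zero])) ((↑u⁻¹ : X →L[ℂ] X) y)
  exact ⟨x, by rw [hu, hx, hmul]⟩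

/-- If `0` is an algebraically simple eigenvalue of a finite-rank perturbation `T` of an invertible
operator, then the small eigenvalues of the operators `B` near `T` are `O(‖B - T‖)`. -/
theorem exists_norm_eigenvalue_le {S F : X →L[ℂ] X} (hS : IsUnit S)
    (hF : FiniteDimensional ℂ (LinearMap.range (F : X →ₗ[ℂ] X))) {v : X} (hv : v ≠ 0)
    (hTv : (S + F) v = 0) (hker : ∀ x, (S + F) x = 0 → ∃ c : ℂ, x = c • v)
    (hker2 : ∀ x, (S + F) ((S + F) x) = 0 → (S + F) x = 0) :
    ∃ c δ : ℝ, 0 < δ ∧ 0 ≤ c ∧ ∀ (B : X →L[ℂ] X) (z : ℂ) (f : X), ‖f‖ = 1 → B f = z • f →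
      ‖z‖ < δ → ‖B - (S + F)‖ < δ → ‖z‖ ≤ c * ‖B - (S + F)‖ := by
  obtain ⟨φ, -, hφ⟩ := exists_dual_vector ℂ v (norm_ne_zero_iff.mpr hv)
  have hφv : φ v ≠ 0 := by
    rw [hφ]
    exact RCLike.ofReal_ne_zero.mpr (norm_ne_zero_iff.mpr hv)
  set T := S + F with hT
  -- Rank-one bordering: `T + Q` no longer kills `v`, and it is still invertible plus finite rank.
  let Q : X →L[ℂ] X := φ.smulRight v
  have hQ : ∀ x, Q x = φ x • v := fun x => rfl
  have hU : IsUnit (T + Q) := by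
    rw [hT, add_assoc]
    refine isUnit_add_of_finiteDimensional_range hS ?_ ?_
    · have : FiniteDimensional ℂ (LinearMap.range (Q : X →ₗ[ℂ] X)) := by
        refine Submodule.finiteDimensional_of_le (S₂ := Submodule.span ℂ {v}) ?_
        rintro _ ⟨x, rfl⟩
        exact Submodule.smul_mem _ _ (Submodule.mem_span_singleton_self v)
      refine Submodule.finiteDimensional_of_le
        (S₂ := LinearMap.range (F : X →ₗ[ℂ] X) ⊔ LinearMap.range (Q : X →ₗ[ℂ] X)) ?_
      rintro _ ⟨x, rfl⟩
      exact Submodule.add_mem_sup ⟨x, rfl⟩ ⟨x, rfl⟩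
    -- `T x` is a multiple of `v`, so `T² x = 0`; ascent one gives `T x = 0`, hence `x = c v`, and
    -- `φ x = 0` forces `c = 0`.
    · intro x hx
      rw [← add_assoc, ← hT, add_apply, hQ] at hx
      have h1 : T x = -(φ x • v) := eq_neg_of_add_eq_zero_left hx
      have h2 : T x = 0 := hker2 x (by rw [h1, map_neg, map_smul, hTv, smul_zero, neg_zero])
      obtain ⟨c, rfl⟩ := hker x h2
      rw [h2, zero_add, map_smul, smul_eq_mul] at hx
      have h3 : c * φ v = 0 := (smul_eq_zero.mp hx).resolve_right hv
      rw [(mul_eq_zero.mp h3).resolve_right hφv, zero_smul]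
  obtain ⟨u, hu⟩ := hU
  let G : X →L[ℂ] X := ↑u⁻¹
  have hG : ∀ x, G (T x + φ x • v) = x := fun x => by
    have : T x + φ x • v = (u : X →L[ℂ] X) x := by rw [hu]; rfl
    rw [this, ← mul_apply_eq_comp, Units.inv_mul, one_apply_eq_self]
  have hGv : φ v • G v = v := by
    have := hG v
    rwa [hTv, zero_add, map_smul] at this
  -- the functional `φ v • φ ∘ G` annihilates the range of `T`, and maps `v` to `φ v`
  let ψ : X →L[ℂ] ℂ := φ v • φ.comp G
  have hψ : ∀ x, ψ x = φ v * φ (G x) := fun x => rfl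
  have hψv : ψ v = φ v := by
    rw [hψ, ← smul_eq_mul, ← map_smul, hGv]
  have hGT : ∀ x, x = G (T x) + φ x • G v := fun x => by
    conv_lhs => rw [← hG x]
    rw [map_add, map_smul]
  -- Apply `φ` to `x = G (T x) + φ x • G v`, where `φ (G v) = 1`.
  have hψT : ∀ x, ψ (T x) = 0 := fun x => by
    have h1 : ψ (T x) = φ v * φ x - φ v * (φ x * φ (G v)) := by
      have h2 := congrArg φ (hGT x)
      rw [map_add, map_smul, smul_eq_mul] at h2
      rw [hψ]
      linear_combination (-φ v) * h2
    have h3 : φ v * φ (G v) = φ v := hψv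
    rw [h1]
    linear_combination (-φ x) * h3
  -- Up to the factor `φ v`, the deviation of `x` from the line through `v` is controlled by `T x`;
  -- `D` below is the resulting constant.
  have hdecomp : ∀ x, φ v • x = ψ x • v + (φ v • G (T x) - ψ (G (T x)) • v) := fun x => by
    have h1 : φ v • x = φ v • G (T x) + φ x • v := by
      conv_lhs => rw [hGT x]
      rw [smul_add, smul_comm (φ v) (φ x), hGv]
    have h2 : ψ x * φ v = ψ (G (T x)) * φ v + φ x * φ v := by
      have := congrArg ψ h1
      rw [map_smul, map_add, map_smul, map_smul, hψv] at this
      simp only [smul_eq_mul] at this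
      linear_combination this
    have h3 : ψ x = ψ (G (T x)) + φ x := by
      apply mul_right_cancel₀ hφv
      linear_combination h2
    rw [h1, h3, add_smul]
    abel
  set D : ℝ := (‖φ v‖ + ‖ψ‖ * ‖v‖) * ‖G‖ with hD
  have hD0 : 0 ≤ D := by positivity
  have hv0 : 0 < ‖v‖ := norm_pos_iff.mpr hv
  have hn0 : 0 < ‖φ v‖ := norm_pos_iff.mpr hφv
  -- The radius makes `‖T f‖` at most twice it, so `D * ‖T f‖ ≤ ‖φ v‖ / 2` and `‖ψ f‖ * ‖v‖ ≥ ‖φ v‖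
  -- / 2`. Dividing `‖z‖ * ‖ψ f‖ ≤ ‖ψ‖ * ‖B - T‖` by this lower bound gives `c`.
  refine ⟨2 * ‖v‖ / ‖φ v‖ * ‖ψ‖, ‖φ v‖ / (4 * (D + 1)), by positivity, by positivity, ?_⟩
  intro B z f hf hBf hz hBT
  have hBTf : ‖(B - T) f‖ ≤ ‖B - T‖ := by simpa [hf] using (B - T).le_opNorm f
  have hTf : T f = z • f - (B - T) f := by
    rw [sub_apply, hBf]; abel
  have hTf' : ‖T f‖ ≤ ‖φ v‖ / (2 * (D + 1)) := by
    rw [hTf]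
    refine (norm_sub_le _ _).trans ?_
    rw [norm_smul, hf, mul_one]
    calc ‖z‖ + ‖(B - T) f‖ ≤ ‖φ v‖ / (4 * (D + 1)) + ‖φ v‖ / (4 * (D + 1)) :=
          add_le_add hz.le (hBTf.trans hBT.le)
      _ = _ := by field_simp; ring
  have hzψ : ‖z‖ * ‖ψ f‖ ≤ ‖ψ‖ * ‖B - T‖ := by
    have h1 : z * ψ f = ψ ((B - T) f) := by
      have := hψT f
      rw [hTf, map_sub, map_smul, smul_eq_mul] at this
      exact sub_eq_zero.mp this
    rw [← norm_mul, h1]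
    exact (ψ.le_opNorm _).trans (by gcongr)
  have hlow : ‖φ v‖ ≤ 2 * (‖ψ f‖ * ‖v‖) := by
    have h1 : ‖φ v‖ ≤ ‖ψ f‖ * ‖v‖ + D * ‖T f‖ := by
      calc ‖φ v‖ = ‖φ v • f‖ := by rw [norm_smul, hf, mul_one]
        _ ≤ ‖ψ f • v‖ + (‖φ v • G (T f)‖ + ‖ψ (G (T f)) • v‖) := by
          rw [hdecomp f]
          exact (norm_add_le _ _).trans (by gcongr; exact norm_sub_le _ _)
        _ ≤ ‖ψ f‖ * ‖v‖ + (‖φ v‖ * (‖G‖ * ‖T f‖) + ‖ψ‖ * (‖G‖ * ‖T f‖) * ‖v‖) := by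
          rw [norm_smul, norm_smul, norm_smul]
          have h2 := G.le_opNorm (T f)
          have h3 := ψ.le_opNorm_of_le h2
          gcongr
        _ = _ := by rw [hD]; ring
    have h2 : D * ‖T f‖ ≤ ‖φ v‖ / 2 := by
      calc D * ‖T f‖ ≤ (D + 1) * (‖φ v‖ / (2 * (D + 1))) := by gcongr; linarith
        _ = _ := by field_simp
    linarith
  rw [div_mul_eq_mul_div, div_mul_eq_mul_div, le_div_iff₀ hn0]
  calc ‖z‖ * ‖φ v‖ ≤ ‖z‖ * (2 * (‖ψ f‖ * ‖v‖)) := by gcongr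
    _ = 2 * ‖v‖ * (‖z‖ * ‖ψ f‖) := by ring
    _ ≤ 2 * ‖v‖ * (‖ψ‖ * ‖B - T‖) := by gcongr
    _ = _ := by ring

end FiniteRank

/-! ### Gauss points -/

/-- Its coefficient of degree `r` is the descending factorial `(2r)(2r-1)⋯(r+1)`, since `(X² - 1)ʳ`
is monic of degree `2r`. -/
theorem legendrePoly_ne_zero (r : ℕ) : legendrePoly r ≠ 0 := by
  intro h
  have hmon : ((Polynomial.X ^ 2 - 1 : Polynomial ℝ) ^ r).Monic :=
    (Polynomial.monic_X_pow_sub_C (1 : ℝ) two_ne_zero).pow r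
  have hdeg : ((Polynomial.X ^ 2 - 1 : Polynomial ℝ) ^ r).natDegree = r + r := by
    have : (Polynomial.X ^ 2 - 1 : Polynomial ℝ).natDegree = 2 :=
      Polynomial.natDegree_X_pow_sub_C (r := (1 : ℝ))
    rw [Polynomial.natDegree_pow, this]
    ring
  have h1 := congrArg (fun p => Polynomial.coeff p r) h
  simp only [legendrePoly, Polynomial.coeff_iterate_derivative, Polynomial.coeff_zero] at h1
  rw [← hdeg, hmon.coeff_natDegree, hdeg, nsmul_eq_mul, mul_one] at h1
  have h2 : (r + r).descFactorial r = 0 := by exact_mod_cast h1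
  rw [Nat.descFactorial_eq_zero_iff_lt] at h2
  omega

/-- Rolle's theorem for the derivative of order `r - 1`. A single node already suffices for the
Lagrange polynomials to sum to 1. -/
theorem gaussPoints_nonempty {r : ℕ} (hr : 0 < r) : (gaussPoints r).Nonempty := by
  set p : Polynomial ℝ := (Polynomial.X ^ 2 - 1) ^ r with hp
  have hp0 : p ≠ 0 := pow_ne_zero _ (Polynomial.X_pow_sub_C_ne_zero two_pos (1 : ℝ))
  -- The points `±1` are zeros of order at least `r`, so they survive `r - 1` differentiations.
  have hroot : ∀ t : ℝ, t ^ 2 = 1 → (Polynomial.derivative^[r - 1] p).eval t = 0 := by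
    intro t ht
    refine Polynomial.isRoot_iterate_derivative_of_lt_rootMultiplicity ?_
    refine lt_of_lt_of_le (Nat.sub_lt hr one_pos)
      ((Polynomial.le_rootMultiplicity_iff hp0).mpr (pow_dvd_pow_of_dvd ?_ r))
    rw [Polynomial.dvd_iff_isRoot]
    simp [ht]
  obtain ⟨c, hc, hc'⟩ := exists_deriv_eq_zero (a := -1) (b := 1) (by norm_num)
    (Polynomial.derivative^[r - 1] p).continuous.continuousOn
    ((hroot (-1) (by norm_num)).trans (hroot 1 (by norm_num)).symm)
  refine ⟨c, Finset.mem_filter.mpr ⟨?_, hc.1.le, hc.2.le⟩⟩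
  rw [Multiset.mem_toFinset, Polynomial.mem_roots (legendrePoly_ne_zero r), Polynomial.IsRoot]
  rw [Polynomial.deriv, ← Function.iterate_succ_apply' Polynomial.derivative,
    Nat.succ_eq_add_one, Nat.sub_add_cancel hr] at hc'
  exact hc'

theorem mem_Icc_of_mem_gaussPoints {r : ℕ} {t : ℝ} (ht : t ∈ gaussPoints r) :
    t ∈ Icc (-1 : ℝ) 1 :=
  (Finset.mem_filter.mp ht).2

/-- The Lagrange basis polynomials of the Gauss points are bounded on `[-1, 1]`. -/
theorem exists_bound_basis (r : ℕ) : ∃ Λ : ℝ, 0 ≤ Λ ∧ ∀ t ∈ Icc (-1 : ℝ) 1,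
    ∑ τ : {τ : ℝ // τ ∈ gaussPoints r}, |(Lagrange.basis (gaussPoints r) id (τ : ℝ)).eval t| ≤ Λ := by
  have hc : Continuous fun t : ℝ => ∑ τ : {τ : ℝ // τ ∈ gaussPoints r},
      |(Lagrange.basis (gaussPoints r) id (τ : ℝ)).eval t| :=
    continuous_finsetSum _ fun τ _ => (Polynomial.continuous _).abs
  obtain ⟨Λ, hΛ⟩ := isCompact_Icc.exists_bound_of_continuousOn (s := Icc (-1 : ℝ) 1) hc.continuousOn
  refine ⟨|Λ|, abs_nonneg _, fun t ht => ?_⟩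
  exact (le_abs_self _).trans ((hΛ t ht).trans (le_abs_self Λ))

theorem sum_basis_eval {r : ℕ} (hr : 0 < r) (t : ℝ) :
    ∑ τ : {τ : ℝ // τ ∈ gaussPoints r},
      (Lagrange.basis (gaussPoints r) id (τ : ℝ)).eval t = 1 := by
  have h := congrArg (Polynomial.eval t)
    (Lagrange.sum_basis (v := id) (s := gaussPoints r) Function.injective_id.injOn
      (gaussPoints_nonempty hr))
  rw [Polynomial.eval_finsetSum, Polynomial.eval_one] at h
  rw [← h]
  exact Finset.sum_coe_sort (gaussPoints r)
    (fun τ => (Lagrange.basis (gaussPoints r) id τ).eval t)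

theorem abs_le_of_mem_Icc {a b z : ℝ} (hz : z ∈ Icc a b) : |z| ≤ |a| + |b| :=
  (abs_le_max_abs_abs hz.1 hz.2).trans
    (max_le_add_of_nonneg (abs_nonneg a) (abs_nonneg b))

/-! ### Partitions -/

namespace Partition

variable {a b : ℝ} (P : Partition a b)

theorem left_lt_right (j : Fin P.n) : P.left j < P.right j :=
  P.strictMono (Fin.castSucc_lt_succ)

theorem le_left (j : Fin P.n) : a ≤ P.left j :=
  P.first.ge.trans (P.strictMono.monotone (Fin.zero_le _))

theorem right_le (j : Fin P.n) : P.right j ≤ b :=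
  (P.strictMono.monotone (Fin.le_last _)).trans P.last.le

theorem Icc_subset (j : Fin P.n) : Icc (P.left j) (P.right j) ⊆ Icc a b :=
  Icc_subset_Icc (P.le_left j) (P.right_le j)

theorem length_le_mesh (j : Fin P.n) : P.right j - P.left j ≤ P.mesh :=
  le_ciSup (f := fun j : Fin P.n => P.right j - P.left j) (finite_range _).bddAbove j

theorem mesh_nonneg : 0 ≤ P.mesh :=
  Real.iSup_nonneg fun j => (sub_pos.mpr (P.left_lt_right j)).le

theorem right_le_left {i j : Fin P.n} (h : i < j) : P.right i ≤ P.left j :=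
  P.strictMono.monotone (Fin.succ_le_castSucc_iff.mpr h)

/-- Every point that is not a node lies in the interior of a subinterval. -/
theorem exists_mem_Ioo {x : ℝ} (hx : x ∈ Icc a b) (hn : x ∉ range P.node) :
    ∃ j : Fin P.n, x ∈ Ioo (P.left j) (P.right j) := by
  by_contra! hcon
  -- If no open subinterval contains `x`, then `x` passes every node in turn, including the last
  -- one, `b`.
  have key : ∀ i : Fin (P.n + 1), P.node i < x := by
    intro i
    induction i using Fin.induction with
    | zero => exact lt_of_le_of_ne (P.first.trans_le hx.1) fun h => hn ⟨_, h⟩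
    | succ i ih =>
      refine lt_of_le_of_ne (not_lt.mp fun h => hcon i ⟨ih, h⟩) fun h => hn ⟨_, h⟩
  exact absurd (key (Fin.last P.n)) (by rw [P.last]; exact not_lt.mpr hx.2)

/-- Discards the nodes, where adjacent closed subintervals overlap and the basis functions of both
may contribute. -/
theorem ae_exists_mem_Ioo :
    ∀ᵐ x ∂(intervalMeasure a b), ∃ j : Fin P.n, x ∈ Ioo (P.left j) (P.right j) := by
  have h : ∀ᵐ x ∂(volume : Measure ℝ), x ∉ range P.node :=
    (measure_eq_zero_iff_ae_notMem).mp ((finite_range P.node).measure_zero _)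
  filter_upwards [ae_restrict_mem measurableSet_Icc, ae_restrict_of_ae h] with x hx hn
  exact P.exists_mem_Ioo hx hn

theorem eq_of_mem_Ioo_of_mem_Icc {x : ℝ} {i j : Fin P.n} (hi : x ∈ Ioo (P.left i) (P.right i))
    (hj : x ∈ Icc (P.left j) (P.right j)) : i = j := by
  rcases lt_trichotomy i j with h | h | h
  · exact absurd ((P.right_le_left h).trans hj.1) (not_le.mpr hi.2)
  · exact h
  · exact absurd (hj.2.trans (P.right_le_left h)) (not_le.mpr hi.1)

theorem stepFun_of_mem_Ioo {x : ℝ} {j : Fin P.n} (hj : x ∈ Ioo (P.left j) (P.right j)) :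
    P.stepFun x = ((((P.left j + P.right j) / 2) ^ 2 : ℝ) : ℂ) := by
  rw [stepFun, Finset.sum_eq_single j]
  · exact indicator_of_mem (Ioo_subset_Ioc_self hj) _
  · intro i _ hij
    exact indicator_of_notMem
      (fun h => hij (P.eq_of_mem_Ioo_of_mem_Icc hj (Ioc_subset_Icc_self h)).symm) _
  · simp

theorem refInv_mem {x : ℝ} {j : Fin P.n} (hj : x ∈ Icc (P.left j) (P.right j)) :
    P.refInv j x ∈ Icc (-1 : ℝ) 1 := by
  have h := sub_pos.mpr (P.left_lt_right j)
  rw [refInv, mem_Icc, le_div_iff₀ h, div_le_iff₀ h]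
  constructor <;> linarith [hj.1, hj.2]

theorem refMap_mem {t : ℝ} (ht : t ∈ Icc (-1 : ℝ) 1) (j : Fin P.n) :
    P.refMap j t ∈ Icc (P.left j) (P.right j) := by
  have h := sub_pos.mpr (P.left_lt_right j)
  rw [refMap]
  constructor <;> nlinarith [ht.1, ht.2]

theorem abs_sub_le_mesh {x y : ℝ} {j : Fin P.n} (hx : x ∈ Icc (P.left j) (P.right j))
    (hy : y ∈ Icc (P.left j) (P.right j)) : |x - y| ≤ P.mesh := by
  refine le_trans ?_ (P.length_le_mesh j)
  rw [abs_le]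
  constructor <;> linarith [hx.1, hx.2, hy.1, hy.2]

theorem norm_sqFun_sub_stepFun_le {x : ℝ} {j : Fin P.n}
    (hj : x ∈ Ioo (P.left j) (P.right j)) :
    ‖sqFun x - P.stepFun x‖ ≤ 2 * (|a| + |b|) * P.mesh := by
  rw [P.stepFun_of_mem_Ioo hj, sqFun, ← Complex.ofReal_sub, Complex.norm_real, Real.norm_eq_abs,
    sq_sub_sq, abs_mul]
  have hlr := P.left_lt_right j
  set y := (P.left j + P.right j) / 2
  have hy : y ∈ Icc (P.left j) (P.right j) := by
    constructor <;> simp only [y] <;> linarith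
  have hb : ∀ z ∈ Icc (P.left j) (P.right j), |z| ≤ |a| + |b| := fun z hz =>
    abs_le_of_mem_Icc (P.Icc_subset j hz)
  have h1 : |x + y| ≤ 2 * (|a| + |b|) := by
    linarith [abs_add_le x y, hb x (Ioo_subset_Icc_self hj), hb y hy]
  exact mul_le_mul h1 (P.abs_sub_le_mesh (Ioo_subset_Icc_self hj) hy) (abs_nonneg _)
    (by positivity)

theorem basisFun_of_mem_Ioo {r : ℕ} {x : ℝ} {j : Fin P.n} (hj : x ∈ Ioo (P.left j) (P.right j))
    (τ : {τ : ℝ // τ ∈ gaussPoints r}) :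
    P.basisFun (j, τ) x = (Lagrange.basis (gaussPoints r) id (τ : ℝ)).eval (P.refInv j x) :=
  indicator_of_mem (Ioo_subset_Icc_self hj) _

theorem basisFun_of_ne {r : ℕ} {x : ℝ} {i j : Fin P.n} (hj : x ∈ Ioo (P.left j) (P.right j))
    (hij : i ≠ j) (τ : {τ : ℝ // τ ∈ gaussPoints r}) : P.basisFun (i, τ) x = 0 :=
  indicator_of_notMem (fun h => hij (P.eq_of_mem_Ioo_of_mem_Icc hj h).symm) _

theorem degKernel_of_mem_Ioo {r : ℕ} (k : ℝ → ℝ → ℂ) {x u : ℝ} {i j : Fin P.n}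
    (hi : x ∈ Ioo (P.left i) (P.right i)) (hj : u ∈ Ioo (P.left j) (P.right j)) :
    P.degKernel r k x u = ∑ σ : {τ : ℝ // τ ∈ gaussPoints r}, ∑ τ : {τ : ℝ // τ ∈ gaussPoints r},
      k (P.refMap i σ) (P.refMap j τ) *
        ((Lagrange.basis (gaussPoints r) id (σ : ℝ)).eval (P.refInv i x) : ℝ) *
        ((Lagrange.basis (gaussPoints r) id (τ : ℝ)).eval (P.refInv j u) : ℝ) := by
  rw [degKernel, Fintype.sum_prod_type, Finset.sum_eq_single i]
  · refine Finset.sum_congr rfl fun σ _ => ?_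
    rw [Fintype.sum_prod_type, Finset.sum_eq_single j]
    · refine Finset.sum_congr rfl fun τ _ => ?_
      rw [P.basisFun_of_mem_Ioo hi, P.basisFun_of_mem_Ioo hj]
      rfl
    · intro l _ hl
      refine Finset.sum_eq_zero fun τ _ => ?_
      rw [P.basisFun_of_ne hj hl, Complex.ofReal_zero, mul_zero]
    · simp
  · intro l _ hl
    refine Finset.sum_eq_zero fun τ _ => Finset.sum_eq_zero fun _ _ => ?_
    rw [P.basisFun_of_ne hi hl, Complex.ofReal_zero, mul_zero, zero_mul]
  · simp

/-- The products of basis values sum to 1, so the error is a combination of differences of `k`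
between points of one cell. Each is at most `L * P.mesh`, as the product carries the max metric, and
the weights have absolute sum at most `Λ ^ 2`. -/
theorem norm_sub_degKernel_le {r : ℕ} (hr : 0 < r) {k : ℝ → ℝ → ℂ} {L : NNReal}
    (hL : LipschitzOnWith L (Function.uncurry k) (Icc a b ×ˢ Icc a b)) {Λ : ℝ} (hΛ0 : 0 ≤ Λ)
    (hΛ : ∀ t ∈ Icc (-1 : ℝ) 1, ∑ τ : {τ : ℝ // τ ∈ gaussPoints r},
      |(Lagrange.basis (gaussPoints r) id (τ : ℝ)).eval t| ≤ Λ)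
    {x u : ℝ} {i j : Fin P.n}
    (hi : x ∈ Ioo (P.left i) (P.right i)) (hj : u ∈ Ioo (P.left j) (P.right j)) :
    ‖k x u - P.degKernel r k x u‖ ≤ L * Λ ^ 2 * P.mesh := by
  have hi' := Ioo_subset_Icc_self hi
  have hj' := Ioo_subset_Icc_self hj
  set p := fun σ : {τ : ℝ // τ ∈ gaussPoints r} =>
    (Lagrange.basis (gaussPoints r) id (σ : ℝ)).eval (P.refInv i x) with hp
  set q := fun σ : {τ : ℝ // τ ∈ gaussPoints r} =>
    (Lagrange.basis (gaussPoints r) id (σ : ℝ)).eval (P.refInv j u) with hq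
  have hk : k x u = ∑ σ, ∑ τ, k x u * (p σ : ℂ) * (q τ : ℂ) := by
    simp_rw [← Finset.mul_sum, ← Finset.sum_mul, ← Finset.mul_sum, ← Complex.ofReal_sum]
    rw [hp, hq]
    rw [sum_basis_eval hr, sum_basis_eval hr, Complex.ofReal_one, mul_one, mul_one]
  have hdeg : P.degKernel r k x u =
      ∑ σ : {τ : ℝ // τ ∈ gaussPoints r}, ∑ τ : {τ : ℝ // τ ∈ gaussPoints r},
      k (P.refMap i σ) (P.refMap j τ) * (p σ : ℂ) * (q τ : ℂ) := P.degKernel_of_mem_Ioo k hi hj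
  rw [hdeg, hk]
  simp_rw [← Finset.sum_sub_distrib, ← sub_mul]
  have hterm : ∀ σ τ : {τ : ℝ // τ ∈ gaussPoints r},
      ‖(k x u - k (P.refMap i σ) (P.refMap j τ)) * (p σ : ℂ) * (q τ : ℂ)‖ ≤
        L * P.mesh * (|p σ| * |q τ|) := by
    intro σ τ
    have hσ := P.refMap_mem (mem_Icc_of_mem_gaussPoints σ.2) i
    have hτ := P.refMap_mem (mem_Icc_of_mem_gaussPoints τ.2) j
    have h1 := hL.dist_le_mul (x, u) ⟨P.Icc_subset i hi', P.Icc_subset j hj'⟩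
      (P.refMap i σ, P.refMap j τ) ⟨P.Icc_subset i hσ, P.Icc_subset j hτ⟩
    have h2 : dist (x, u) (P.refMap i σ, P.refMap j τ) ≤ P.mesh :=
      max_le (P.abs_sub_le_mesh hi' hσ) (P.abs_sub_le_mesh hj' hτ)
    rw [norm_mul, norm_mul, Complex.norm_real, Complex.norm_real, Real.norm_eq_abs,
      Real.norm_eq_abs, mul_assoc]
    refine mul_le_mul_of_nonneg_right ?_ (by positivity)
    rw [dist_eq_norm] at h1
    exact h1.trans (by gcongr)
  calc _ ≤ ∑ σ, ∑ τ, L * P.mesh * (|p σ| * |q τ|) :=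
        norm_sum_le_of_le _ fun σ _ => norm_sum_le_of_le _ fun τ _ => hterm σ τ
    _ = L * P.mesh * ((∑ σ, |p σ|) * ∑ τ, |q τ|) := by
        simp_rw [← Finset.mul_sum, Finset.sum_mul_sum, Finset.mul_sum]
    _ ≤ L * P.mesh * (Λ * Λ) := by
        have := P.mesh_nonneg
        gcongr
        · exact hΛ _ (P.refInv_mem hi')
        · exact hΛ _ (P.refInv_mem hj')
    _ = _ := by ring

end Partition

/-- Uniform partitions have arbitrarily small mesh. -/
theorem exists_partition_mesh_le {a b : ℝ} (hab : a < b) {δ : ℝ} (hδ : 0 < δ) :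
    ∃ P : Partition a b, P.mesh ≤ δ := by
  obtain ⟨N, hN⟩ := exists_nat_gt ((b - a) / δ)
  have hba := sub_pos.mpr hab
  have hN0 : (0 : ℝ) < N := (div_pos hba hδ).trans hN
  refine ⟨⟨N, fun i => a + i * ((b - a) / N), ?_, by simp, ?_⟩, ?_⟩
  · intro i j hij
    have h : ((i : ℕ) : ℝ) < ((j : ℕ) : ℝ) := by exact_mod_cast hij
    have := div_pos hba hN0
    simp only [add_lt_add_iff_left]
    gcongr
  · rw [Fin.val_last]
    field_simp
    ring
  · have : Nonempty (Fin N) := ⟨⟨0, by exact_mod_cast hN0⟩⟩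
    refine ciSup_le fun j => ?_
    simp only [Partition.left, Partition.right, Fin.val_succ, Fin.val_castSucc]
    push_cast
    rw [div_lt_iff₀ hδ] at hN
    have : (b - a) / N ≤ δ := by
      rw [div_le_iff₀ hN0]; linarith
    linarith

/-! ### Integral and multiplication operators on `L^∞[a, b]` -/

variable {a b : ℝ}

theorem norm_le_of_ae_norm_le {f : LInf a b} {C : ℝ} (hC : 0 ≤ C)
    (h : ∀ᵐ x ∂(intervalMeasure a b), ‖f x‖ ≤ C) : ‖f‖ ≤ C := by
  simpa using Lp.norm_le_of_ae_bound hC h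

theorem integralOp_ae_eq {κ : ℝ → ℝ → ℂ} (hκ : IsBddKernel a b κ) (f : LInf a b) :
    integralOp hκ f =ᵐ[intervalMeasure a b] fun x => ∫ u in Icc a b, κ x u * f u :=
  MemLp.coeFn_toLp (integrand_memLp hκ f)

theorem multOp_ae_eq {m : ℝ → ℂ} (hm : MemLp m ∞ (intervalMeasure a b)) (f : LInf a b) :
    multOp hm f =ᵐ[intervalMeasure a b] fun x => m x * f x := by
  have h := ContinuousLinearMap.coeFn_holder (r := ∞) (ContinuousLinearMap.mul ℂ ℂ) (hm.toLp m) f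
  filter_upwards [h, hm.coeFn_toLp] with x h1 h2
  rw [← h2]
  exact h1

theorem intervalMeasure_real_univ (hab : a < b) : (intervalMeasure a b).real univ = b - a := by
  rw [measureReal_restrict_apply MeasurableSet.univ, univ_inter, Real.volume_real_Icc_of_le hab.le]

theorem norm_integralOp_sub_le (hab : a < b) {κ κ' : ℝ → ℝ → ℂ} (hκ : IsBddKernel a b κ)
    (hκ' : IsBddKernel a b κ') {D : ℝ} (hD : 0 ≤ D)
    (h : ∀ᵐ x ∂(intervalMeasure a b), ∀ᵐ u ∂(intervalMeasure a b), ‖κ x u - κ' x u‖ ≤ D) :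
    ‖integralOp hκ - integralOp hκ'‖ ≤ D * (b - a) := by
  have hba := sub_nonneg.mpr hab.le
  refine ContinuousLinearMap.opNorm_le_bound _ (by positivity) fun f => ?_
  refine norm_le_of_ae_norm_le (by positivity) ?_
  filter_upwards [integralOp_ae_eq hκ f, integralOp_ae_eq hκ' f, h, integrand_integrable hκ f,
    integrand_integrable hκ' f, Lp.coeFn_sub (integralOp hκ f) (integralOp hκ' f)]
    with x h1 h2 h3 h4 h5 h6
  rw [sub_apply, h6, Pi.sub_apply, h1, h2, ← integral_sub h4 h5]
  calc _ ≤ D * ‖f‖ * (intervalMeasure a b).real univ := by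
        refine norm_integral_le_of_norm_le_const ?_
        filter_upwards [h3, ae_norm_le f] with u hu hf
        rw [← sub_mul, norm_mul]
        gcongr
    _ = _ := by rw [intervalMeasure_real_univ hab]; ring

theorem norm_multOp_sub_le {m m' : ℝ → ℂ} (hm : MemLp m ∞ (intervalMeasure a b))
    (hm' : MemLp m' ∞ (intervalMeasure a b)) {D : ℝ} (hD : 0 ≤ D)
    (h : ∀ᵐ x ∂(intervalMeasure a b), ‖m x - m' x‖ ≤ D) :
    ‖multOp hm - multOp hm'‖ ≤ D := by
  refine ContinuousLinearMap.opNorm_le_bound _ hD fun f => ?_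
  refine norm_le_of_ae_norm_le (by positivity) ?_
  filter_upwards [multOp_ae_eq hm f, multOp_ae_eq hm' f, h, ae_norm_le f,
    Lp.coeFn_sub (multOp hm f) (multOp hm' f)] with x h1 h2 h3 h4 h5
  rw [sub_apply, h5, Pi.sub_apply, h1, h2, ← sub_mul, norm_mul]
  gcongr

theorem multOp_mul_eq_one {m m' : ℝ → ℂ} (hm : MemLp m ∞ (intervalMeasure a b))
    (hm' : MemLp m' ∞ (intervalMeasure a b)) (h : ∀ᵐ x ∂(intervalMeasure a b), m x * m' x = 1) :
    multOp hm * multOp hm' = 1 := by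
  ext1 f
  refine Lp.ext ?_
  rw [mul_apply_eq_comp, one_apply_eq_self]
  filter_upwards [multOp_ae_eq hm (multOp hm' f), multOp_ae_eq hm' f, h] with x h1 h2 h3
  rw [h1, h2, ← mul_assoc, h3, one_mul]

theorem isUnit_multOp {m : ℝ → ℂ} (hm : MemLp m ∞ (intervalMeasure a b)) {c : ℝ} (hc : 0 < c)
    (h : ∀ᵐ x ∂(intervalMeasure a b), c ≤ ‖m x‖) : IsUnit (multOp hm) := by
  have hinv : MemLp (fun x => (m x)⁻¹) ∞ (intervalMeasure a b) := by
    refine memLp_top_of_bound hm.1.aemeasurable.inv.aestronglyMeasurable c⁻¹ ?_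
    filter_upwards [h] with x hx
    rw [norm_inv]
    exact inv_anti₀ hc hx
  have hne : ∀ᵐ x ∂(intervalMeasure a b), m x ≠ 0 := by
    filter_upwards [h] with x hx
    exact norm_pos_iff.mp (hc.trans_le hx)
  exact ⟨⟨multOp hm, multOp hinv,
    multOp_mul_eq_one hm hinv (hne.mono fun x hx => mul_inv_cancel₀ hx),
    multOp_mul_eq_one hinv hm (hne.mono fun x hx => inv_mul_cancel₀ hx)⟩, rfl⟩

theorem algebraMap_add_multOp {m : ℝ → ℂ} (hm : MemLp m ∞ (intervalMeasure a b)) (z : ℂ)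
    (hm' : MemLp (fun x => z + m x) ∞ (intervalMeasure a b)) :
    algebraMap ℂ (LInf a b →L[ℂ] LInf a b) z + multOp hm = multOp hm' := by
  ext1 f
  refine Lp.ext ?_
  rw [add_apply, Algebra.algebraMap_eq_smul_one, smul_apply, one_apply_eq_self]
  filter_upwards [multOp_ae_eq hm f, multOp_ae_eq hm' f, Lp.coeFn_add (z • f) (multOp hm f),
    Lp.coeFn_smul z f] with x h1 h2 h3 h4
  rw [h3, Pi.add_apply, h4, Pi.smul_apply, h1, h2, smul_eq_mul, add_mul]

theorem Partition.basisFun_memLp (P : Partition a b) {r : ℕ} (i : P.Index r) :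
    MemLp (fun x => (P.basisFun i x : ℂ)) ∞ (intervalMeasure a b) := by
  obtain ⟨C, hC⟩ := P.basisFun_bound i
  refine memLp_top_of_bound
    (Complex.measurable_ofReal.comp (P.measurable_basisFun i)).aestronglyMeasurable C ?_
  exact Eventually.of_forall fun x => by rw [Complex.norm_real]; exact hC x

theorem integrable_mul_LInf {g : ℝ → ℂ} (hg : MemLp g ∞ (intervalMeasure a b)) (f : LInf a b) :
    Integrable (fun u => g u * f u) (intervalMeasure a b) := by
  have h : MemLp (fun u => g u * f u) ∞ (intervalMeasure a b) :=
    (Lp.memLp (multOp hg f)).ae_eq (multOp_ae_eq hg f)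
  exact h.integrable le_top

/-- The integral operator of a degenerate kernel has finite rank. -/
theorem finiteDimensional_range_degKernel (P : Partition a b) (r : ℕ) (k : ℝ → ℝ → ℂ) :
    FiniteDimensional ℂ (LinearMap.range
      (integralOp (P.degKernel_isBddKernel r k) : LInf a b →ₗ[ℂ] LInf a b)) := by
  let w : P.Index r → LInf a b := fun i => (P.basisFun_memLp i).toLp _
  have : FiniteDimensional ℂ (Submodule.span ℂ (range w)) :=
    FiniteDimensional.span_of_finite ℂ (finite_range w)
  refine Submodule.finiteDimensional_of_le (S₂ := Submodule.span ℂ (range w)) ?_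
  rintro _ ⟨f, rfl⟩
  let c : P.Index r → ℂ := fun i => ∑ j : P.Index r,
    k (P.gaussNode i) (P.gaussNode j) * ∫ u in Icc a b, (P.basisFun j u : ℂ) * f u
  have hint : ∀ x, ∫ u in Icc a b, P.degKernel r k x u * f u = ∑ i, c i * (P.basisFun i x : ℂ) := by
    intro x
    have h1 : ∀ u, P.degKernel r k x u * f u = ∑ i : P.Index r, ∑ j : P.Index r,
        (k (P.gaussNode i) (P.gaussNode j) * (P.basisFun i x : ℂ)) *
          ((P.basisFun j u : ℂ) * f u) := by
      intro u
      rw [Partition.degKernel, Finset.sum_mul]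
      refine Finset.sum_congr rfl fun i _ => ?_
      rw [Finset.sum_mul]
      exact Finset.sum_congr rfl fun j _ => by ring
    have hi : ∀ i j : P.Index r, Integrable (fun u =>
        (k (P.gaussNode i) (P.gaussNode j) * (P.basisFun i x : ℂ)) *
          ((P.basisFun j u : ℂ) * f u)) (intervalMeasure a b) := fun i j =>
      (integrable_mul_LInf (P.basisFun_memLp j) f).const_mul _
    simp_rw [h1]
    rw [integral_finsetSum _ fun i _ => integrable_finsetSum _ fun j _ => hi i j]
    refine Finset.sum_congr rfl fun i _ => ?_
    rw [integral_finsetSum _ fun j _ => hi i j, Finset.sum_mul]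
    refine Finset.sum_congr rfl fun j _ => ?_
    rw [integral_const_mul]
    ring
  have hsum : integralOp (P.degKernel_isBddKernel r k) f = ∑ i, c i • w i := by
    refine Lp.ext ?_
    have hw : ∀ᵐ x ∂(intervalMeasure a b), ∀ i, (c i • w i : LInf a b) x =
        c i * (P.basisFun i x : ℂ) := by
      rw [ae_all_iff]
      intro i
      filter_upwards [Lp.coeFn_smul (c i) (w i), (P.basisFun_memLp i).coeFn_toLp] with x h1 h2
      rw [h1, Pi.smul_apply, h2, smul_eq_mul]
    filter_upwards [integralOp_ae_eq (P.degKernel_isBddKernel r k) f, hw,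
      Lp.coeFn_finsetSum Finset.univ fun i => c i • w i] with x h1 h2 h3
    rw [h1, hint, h3, Finset.sum_apply]
    exact Finset.sum_congr rfl fun i _ => (h2 i).symm
  change integralOp (P.degKernel_isBddKernel r k) f ∈ _
  rw [hsum]
  exact Submodule.sum_mem _ fun i _ =>
    Submodule.smul_mem _ _ (Submodule.subset_span (mem_range_self i))

/-! ### Norm convergence -/

/-- A `C¹` kernel is Lipschitz on the compact convex square, and `Λ` depends on `r` alone, so the
constant is uniform in the partition. -/
theorem exists_norm_integralOp_sub_degKernel_le (hab : a < b) {r : ℕ} (hr : 0 < r)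
    {k : ℝ → ℝ → ℂ} (hk : ContDiffOn ℝ r (Function.uncurry k) (Icc a b ×ˢ Icc a b)) :
    ∃ C : ℝ, ∀ P : Partition a b, ‖integralOp (isBddKernel_of_continuousOn hk.continuousOn) -
      integralOp (P.degKernel_isBddKernel r k)‖ ≤ C * P.mesh := by
  obtain ⟨L, hL⟩ := hk.exists_lipschitzOnWith (by exact_mod_cast hr.ne')
    ((convex_Icc a b).prod (convex_Icc a b)) (isCompact_Icc.prod isCompact_Icc)
  obtain ⟨Λ, hΛ0, hΛ⟩ := exists_bound_basis r
  refine ⟨L * Λ ^ 2 * (b - a), fun P => ?_⟩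
  have hm := P.mesh_nonneg
  rw [mul_right_comm]
  refine norm_integralOp_sub_le hab _ _ (by positivity) ?_
  filter_upwards [P.ae_exists_mem_Ioo] with x hx
  obtain ⟨i, hi⟩ := hx
  filter_upwards [P.ae_exists_mem_Ioo] with u hu
  obtain ⟨j, hj⟩ := hu
  exact P.norm_sub_degKernel_le hr hL hΛ0 hΛ hi hj

theorem norm_multOp_sqFun_sub_stepFun_le (P : Partition a b) :
    ‖multOp (sqFun_memLp a b) - multOp P.stepFun_memLp‖ ≤ 2 * (|a| + |b|) * P.mesh := by
  have hm := P.mesh_nonneg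
  refine norm_multOp_sub_le _ _ (by positivity) ?_
  filter_upwards [P.ae_exists_mem_Ioo] with x ⟨i, hi⟩
  exact P.norm_sqFun_sub_stepFun_le hi

theorem exists_norm_opA_sub_opApprox_le (hab : a < b) (α : ℝ) {r : ℕ} (hr : 0 < r)
    {k : ℝ → ℝ → ℂ} (hk : ContDiffOn ℝ r (Function.uncurry k) (Icc a b ×ˢ Icc a b)) :
    ∃ C : ℝ, ∀ P : Partition a b, ‖opA α hk.continuousOn - opApprox α k r P‖ ≤ C * P.mesh := by
  obtain ⟨C, hC⟩ := exists_norm_integralOp_sub_degKernel_le hab hr hk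
  refine ⟨|α| * C + 2 * (|a| + |b|), fun P => ?_⟩
  have h : opA α hk.continuousOn - opApprox α k r P =
      (α : ℂ) • (integralOp (isBddKernel_of_continuousOn hk.continuousOn) -
        integralOp (P.degKernel_isBddKernel r k)) -
      (multOp (sqFun_memLp a b) - multOp P.stepFun_memLp) := by
    rw [opA, opApprox, smul_sub]
    abel
  rw [h, add_mul]
  refine (norm_sub_le _ _).trans (add_le_add ?_ (norm_multOp_sqFun_sub_stepFun_le P))
  rw [norm_smul, Complex.norm_real, Real.norm_eq_abs, mul_assoc]
  exact mul_le_mul_of_nonneg_left (hC P) (abs_nonneg α)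

/-! ### Spectral points of the approximating operators are eigenvalues -/

/-- The function on `[a, b]` that equals the polynomial `p` on `[c, d]`, and `0` elsewhere. -/
noncomputable def polyIndicator (c d : ℝ) (p : Polynomial ℂ) : ℝ → ℂ :=
  (Icc c d).indicator fun x => p.eval (x : ℂ)

theorem continuous_eval_ofReal (p : Polynomial ℂ) : Continuous fun x : ℝ => p.eval (x : ℂ) :=
  p.continuous.comp Complex.continuous_ofReal

theorem polyIndicator_memLp (a b c d : ℝ) (p : Polynomial ℂ) :
    MemLp (polyIndicator c d p) ∞ (intervalMeasure a b) := by
  obtain ⟨C, hC⟩ := (isCompact_Icc (a := a) (b := b)).exists_bound_of_continuousOn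
    (continuous_eval_ofReal p).continuousOn
  refine MemLp.indicator measurableSet_Icc
    (memLp_top_of_bound (continuous_eval_ofReal p).aestronglyMeasurable C ?_)
  filter_upwards [ae_restrict_mem measurableSet_Icc] with x hx
  exact hC x hx

/-- The polynomials, restricted to `[c, d]`, as elements of `L^∞[a, b]`. -/
noncomputable def polyLp (a b c d : ℝ) : Polynomial ℂ →ₗ[ℂ] LInf a b where
  toFun p := (polyIndicator_memLp a b c d p).toLp _
  map_add' p q := by
    rw [← MemLp.toLp_add]
    refine MemLp.toLp_congr _ _ (Eventually.of_forall fun x => ?_)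
    by_cases hx : x ∈ Icc c d <;> simp [polyIndicator, hx]
  map_smul' z p := by
    rw [RingHom.id_apply, ← MemLp.toLp_const_smul]
    refine MemLp.toLp_congr _ _ (Eventually.of_forall fun x => ?_)
    by_cases hx : x ∈ Icc c d <;> simp [polyIndicator, hx]

theorem polyLp_ae_eq (a b c d : ℝ) (p : Polynomial ℂ) :
    polyLp a b c d p =ᵐ[intervalMeasure a b] polyIndicator c d p :=
  (polyIndicator_memLp a b c d p).coeFn_toLp

/-- A nonzero polynomial has finitely many zeros. This provides an infinite-dimensional space of
functions living on one subinterval. -/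
theorem polyLp_injective {c d : ℝ} (hcd : c < d) (hsub : Icc c d ⊆ Icc a b) :
    Function.Injective (polyLp a b c d) := by
  rw [injective_iff_map_eq_zero]
  intro p hp
  by_contra hp0
  have h1 : ∀ᵐ x ∂(intervalMeasure a b), polyIndicator c d p x = 0 := by
    have h := polyLp_ae_eq a b c d p
    rw [hp] at h
    filter_upwards [h, Lp.coeFn_zero ℂ ∞ (intervalMeasure a b)] with x h1 h2
    rw [← h1, h2, Pi.zero_apply]
  have h2 : ∀ᵐ x : ℝ ∂(volume.restrict (Icc c d)), p.eval (x : ℂ) = 0 := by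
    filter_upwards [ae_restrict_of_ae_restrict_of_subset hsub h1, ae_restrict_mem measurableSet_Icc]
      with x hx hx'
    rwa [polyIndicator, indicator_of_mem hx'] at hx
  have hfin : {x : ℝ | p.eval (x : ℂ) = 0}.Finite := by
    refine Set.Finite.subset ((p.rootSet_finite ℂ).preimage
      (f := fun x : ℝ => (x : ℂ)) Complex.ofReal_injective.injOn) fun x hx => ?_
    rw [mem_preimage, Polynomial.mem_rootSet]
    exact ⟨hp0, by simpa using hx⟩
  have h3 : ∀ᵐ x : ℝ ∂(volume.restrict (Icc c d)), p.eval (x : ℂ) ≠ 0 :=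
    ae_restrict_of_ae (measure_eq_zero_iff_ae_notMem.mp (hfin.measure_zero volume))
  have h4 : volume.restrict (Icc c d) = 0 := by
    rw [← ae_eq_bot, ← eventually_false_iff_eq_bot]
    filter_upwards [h2, h3] with x hx hx' using hx' hx
  rw [Measure.restrict_eq_zero, Real.volume_Icc, ENNReal.ofReal_eq_zero] at h4
  linarith

theorem opApprox_apply (α : ℝ) (k : ℝ → ℝ → ℂ) (r : ℕ) (P : Partition a b) (f : LInf a b) :
    opApprox α k r P f =
      (α : ℂ) • integralOp (P.degKernel_isBddKernel r k) f - multOp P.stepFun_memLp f :=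
  rfl

/-- The values of `-s_{N_h}` are eigenvalues, with eigenfunctions supported in one subinterval. -/
theorem exists_eigenfunction_of_stepFun (α : ℝ) (k : ℝ → ℝ → ℂ) (r : ℕ) (P : Partition a b)
    (j : Fin P.n) :
    ∃ f : LInf a b, f ≠ 0 ∧ opApprox α k r P f =
      (-((((P.left j + P.right j) / 2) ^ 2 : ℝ) : ℂ)) • f := by
  have hfin := finiteDimensional_range_degKernel P r k
  set K : LInf a b →ₗ[ℂ] LInf a b := (integralOp (P.degKernel_isBddKernel r k)).toLinearMap
  let Φ := polyLp a b (P.left j) (P.right j)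
  have hΦ : Function.Injective Φ := polyLp_injective (P.left_lt_right j) (P.Icc_subset j)
  -- An infinite-dimensional space cannot embed in the finite-dimensional range of `K`, so `K` kills
  -- a nonzero piecewise polynomial, on which only the constant multiplication acts.
  have hni : ¬ Function.Injective (K.rangeRestrict.comp Φ) := fun h =>
    Polynomial.not_finite (Module.Finite.of_injective _ h)
  rw [injective_iff_map_eq_zero] at hni
  push Not at hni
  obtain ⟨p, hp, hp0⟩ := hni
  have hKp : K (Φ p) = 0 := congrArg Subtype.val hp
  refine ⟨Φ p, fun h => hp0 ((injective_iff_map_eq_zero _).mp hΦ p h), ?_⟩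
  rw [opApprox_apply]
  change (α : ℂ) • K (Φ p) - _ = _
  rw [hKp, smul_zero, zero_sub, neg_smul]
  congr 1
  refine Lp.ext ?_
  filter_upwards [multOp_ae_eq P.stepFun_memLp (Φ p),
    Lp.coeFn_smul ((((P.left j + P.right j) / 2) ^ 2 : ℝ) : ℂ) (Φ p),
    polyLp_ae_eq a b (P.left j) (P.right j) p, P.ae_exists_mem_Ioo] with x h1 h2 h3 h4
  obtain ⟨i, hi⟩ := h4
  rw [h1, h2, Pi.smul_apply, smul_eq_mul, P.stepFun_of_mem_Ioo hi]
  by_cases hij : i = j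
  · rw [hij]
  · have h5 : (Φ p) x = 0 := by
      rw [h3]
      exact indicator_of_notMem (fun h => hij (P.eq_of_mem_Ioo_of_mem_Icc hi h)) _
    rw [h5, mul_zero, mul_zero]

theorem exists_eigenfunction_opApprox (α : ℝ) (k : ℝ → ℝ → ℂ) (r : ℕ)
    (P : Partition a b) {z : ℂ} (hz : z ∈ spectrum ℂ (opApprox α k r P)) :
    ∃ f : LInf a b, f ≠ 0 ∧ opApprox α k r P f = z • f := by
  by_cases hstep : ∃ j : Fin P.n, z = -((((P.left j + P.right j) / 2) ^ 2 : ℝ) : ℂ)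
  · obtain ⟨j, rfl⟩ := hstep
    exact exists_eigenfunction_of_stepFun α k r P j
  · push Not at hstep
    by_contra! hcon
    refine hz ?_
    have hm : MemLp (fun x => z + P.stepFun x) ∞ (intervalMeasure a b) :=
      (memLp_const z).add P.stepFun_memLp
    -- The step function takes finitely many values almost everywhere, so avoiding each of them
    -- means avoiding them uniformly.
    have hpos : ∃ c : ℝ, 0 < c ∧ ∀ j : Fin P.n,
        c ≤ ‖z + ((((P.left j + P.right j) / 2) ^ 2 : ℝ) : ℂ)‖ := by
      rcases isEmpty_or_nonempty (Fin P.n) with h | h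
      · exact ⟨1, one_pos, fun j => h.elim j⟩
      · obtain ⟨j, hj⟩ := Finite.exists_min fun j : Fin P.n =>
          ‖z + ((((P.left j + P.right j) / 2) ^ 2 : ℝ) : ℂ)‖
        exact ⟨_, norm_pos_iff.mpr fun h => hstep j (eq_neg_of_add_eq_zero_left h), hj⟩
    obtain ⟨c, hc, hcj⟩ := hpos
    have hS : IsUnit (multOp hm) := by
      refine isUnit_multOp hm hc ?_
      filter_upwards [P.ae_exists_mem_Ioo] with x ⟨j, hj⟩
      rw [P.stepFun_of_mem_Ioo hj]
      exact hcj j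
    have hfin := finiteDimensional_range_degKernel P r k
    set K := integralOp (P.degKernel_isBddKernel r k)
    have hF : FiniteDimensional ℂ (LinearMap.range
        ((-((α : ℂ) • K) : LInf a b →L[ℂ] LInf a b) : LInf a b →ₗ[ℂ] LInf a b)) := by
      refine Submodule.finiteDimensional_of_le (S₂ := LinearMap.range (K : LInf a b →ₗ[ℂ] LInf a b)) ?_
      rintro _ ⟨f, rfl⟩
      exact Submodule.neg_mem _ (Submodule.smul_mem _ _ ⟨f, rfl⟩)
    have heq : algebraMap ℂ (LInf a b →L[ℂ] LInf a b) z - opApprox α k r P =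
        multOp hm + -((α : ℂ) • K) := by
      rw [← algebraMap_add_multOp P.stepFun_memLp z hm, opApprox]
      abel
    rw [spectrum.mem_resolventSet_iff, heq]
    refine isUnit_add_of_finiteDimensional_range hS hF fun f hf => ?_
    by_contra hf0
    refine hcon f hf0 ?_
    rw [← heq, sub_apply, Algebra.algebraMap_eq_smul_one, smul_apply, one_apply_eq_self] at hf
    exact (sub_eq_zero.mp hf).symm

theorem isEigenvalue_of_mem_spectrum_opApprox (α : ℝ) (k : ℝ → ℝ → ℂ) (r : ℕ)
    (P : Partition a b) {z : ℂ} (hz : z ∈ spectrum ℂ (opApprox α k r P)) :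
    IsEigenvalue (opApprox α k r P) z := by
  obtain ⟨f, hf0, hf⟩ := exists_eigenfunction_opApprox α k r P hz
  exact Module.End.hasEigenvalue_of_hasEigenvector
    ⟨Module.End.mem_eigenspace_iff.mpr hf, hf0⟩

/-! ### The essential spectrum -/

theorem exists_norm_le_of_isUnit {T : LInf a b →L[ℂ] LInf a b} (hT : IsUnit T) :
    ∃ M : ℝ, 0 ≤ M ∧ ∀ f, ‖f‖ ≤ M * ‖T f‖ := by
  obtain ⟨u, rfl⟩ := hT
  refine ⟨‖(↑u⁻¹ : LInf a b →L[ℂ] LInf a b)‖, norm_nonneg _, fun f => ?_⟩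
  have h : (↑u⁻¹ : LInf a b →L[ℂ] LInf a b) ((u : LInf a b →L[ℂ] LInf a b) f) = f := by
    rw [← mul_apply_eq_comp, Units.inv_mul, one_apply_eq_self]
  conv_lhs => rw [← h]
  exact ContinuousLinearMap.le_opNorm _ _

/-- Indicators of short intervals around `x₀` are approximate eigenfunctions: `x²` varies little
there, and the integral term is bounded by the length of the interval. -/
theorem norm_opA_indicator_le (α : ℝ) {k : ℝ → ℝ → ℂ}
    (hk : ContinuousOn (Function.uncurry k) (Icc a b ×ˢ Icc a b)) {C : ℝ} (hC0 : 0 ≤ C)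
    (hC : ∀ x ∈ Icc a b, ∀ u ∈ Icc a b, ‖k x u‖ ≤ C) {x₀ c d : ℝ} (hx₀ : x₀ ∈ Icc c d)
    (hsub : Icc c d ⊆ Icc a b) (h : intervalMeasure a b (Icc c d) ≠ ∞) :
    ‖(algebraMap ℂ (LInf a b →L[ℂ] LInf a b) (-sqFun x₀) - opA α hk)
      (indicatorConstLp ∞ measurableSet_Icc h (1 : ℂ))‖ ≤
      (2 * (|a| + |b|) + |α| * C) * (d - c) := by
  have hcd : c ≤ d := hx₀.1.trans hx₀.2
  have hdc := sub_nonneg.mpr hcd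
  set f : LInf a b := indicatorConstLp ∞ measurableSet_Icc h (1 : ℂ) with hf
  set K := integralOp (isBddKernel_of_continuousOn hk) with hK
  have hfx : f =ᵐ[intervalMeasure a b] (Icc c d).indicator fun _ => (1 : ℂ) :=
    indicatorConstLp_coeFn
  have hap : (algebraMap ℂ (LInf a b →L[ℂ] LInf a b) (-sqFun x₀) - opA α hk) f =
      (multOp (sqFun_memLp a b) f - sqFun x₀ • f) - (α : ℂ) • K f := by
    rw [sub_apply, Algebra.algebraMap_eq_smul_one, smul_apply, one_apply_eq_self, opA, sub_apply,
      smul_apply, neg_smul]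
    abel
  rw [hap, add_mul]
  refine (norm_sub_le _ _).trans (add_le_add ?_ ?_)
  · refine norm_le_of_ae_norm_le (by positivity) ?_
    filter_upwards [Lp.coeFn_sub (multOp (sqFun_memLp a b) f) (sqFun x₀ • f),
      multOp_ae_eq (sqFun_memLp a b) f, Lp.coeFn_smul (sqFun x₀) f, hfx] with x h1 h2 h3 h4
    rw [h1, Pi.sub_apply, h2, h3, Pi.smul_apply, smul_eq_mul, h4]
    by_cases hx : x ∈ Icc c d
    · rw [indicator_of_mem hx, mul_one, mul_one, sqFun, sqFun, ← Complex.ofReal_sub,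
        Complex.norm_real, Real.norm_eq_abs, sq_sub_sq, abs_mul]
      have hb : ∀ z ∈ Icc c d, |z| ≤ |a| + |b| := fun z hz => abs_le_of_mem_Icc (hsub hz)
      have h5 : |x - x₀| ≤ d - c := by
        rw [abs_le]
        constructor <;> linarith [hx.1, hx.2, hx₀.1, hx₀.2]
      have h6 : |x + x₀| ≤ 2 * (|a| + |b|) := by
        linarith [abs_add_le x x₀, hb x hx, hb x₀ hx₀]
      exact mul_le_mul h6 h5 (abs_nonneg _) (by positivity)
    · rw [indicator_of_notMem hx, mul_zero, mul_zero, sub_zero, norm_zero]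
      positivity
  · rw [norm_smul, Complex.norm_real, Real.norm_eq_abs, mul_assoc]
    refine mul_le_mul_of_nonneg_left (norm_le_of_ae_norm_le (by positivity) ?_) (abs_nonneg α)
    filter_upwards [integralOp_ae_eq (isBddKernel_of_continuousOn hk) f,
      ae_restrict_mem measurableSet_Icc] with x h1 hx
    rw [hK, h1]
    have h2 : ∫ u in Icc a b, k x u * f u = ∫ u in Icc c d, k x u := by
      calc _ = ∫ u in Icc a b, (Icc c d).indicator (fun u => k x u) u := by
            refine integral_congr_ae ?_
            filter_upwards [hfx] with u hu
            rw [hu]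
            by_cases hu' : u ∈ Icc c d <;> simp [hu']
        _ = ∫ u in Icc c d, k x u := by
            rw [setIntegral_indicator measurableSet_Icc, inter_eq_self_of_subset_right hsub]
    rw [h2]
    have h3 := norm_setIntegral_le_of_norm_le_const (μ := volume) (s := Icc c d) (C := C)
      (f := fun u => k x u) (by simp) fun u hu => hC x hx u (hsub hu)
    rwa [Real.volume_real_Icc_of_le hcd] at h3

/-- The values of `-x²` on `[a, b]` belong to the spectrum of `A`. -/
theorem neg_sqFun_mem_spectrum (hab : a < b) (α : ℝ) {k : ℝ → ℝ → ℂ}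
    (hk : ContinuousOn (Function.uncurry k) (Icc a b ×ˢ Icc a b)) {x₀ : ℝ} (hx₀ : x₀ ∈ Icc a b) :
    -sqFun x₀ ∈ spectrum ℂ (opA α hk) := by
  by_contra hcon
  obtain ⟨M, hM0, hM⟩ := exists_norm_le_of_isUnit (spectrum.notMem_iff.mp hcon)
  obtain ⟨-, C, hC⟩ := isBddKernel_of_continuousOn hk
  set D := M * (2 * (|a| + |b|) + |α| * |C|) with hD
  have hD0 : 0 ≤ D := by positivity
  -- Chosen so that `D * (2 * δ) ≤ 1 / 2`, while the unit-norm indicator would force `1 ≤ D * (2 *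
  -- δ)`.
  set δ := 1 / (4 * (D + 1)) with hδ
  have hδ0 : 0 < δ := by positivity
  -- Truncation to `[a, b]` keeps positive length even if `x₀` is an endpoint.
  set c := max a (x₀ - δ)
  set d := min b (x₀ + δ)
  have hcd : c < d := max_lt (lt_min hab (by linarith [hx₀.1])) (lt_min (by linarith [hx₀.2])
    (by linarith))
  have hx₀' : x₀ ∈ Icc c d := ⟨max_le hx₀.1 (by linarith), le_min hx₀.2 (by linarith)⟩
  have hsub : Icc c d ⊆ Icc a b := Icc_subset_Icc (le_max_left _ _) (min_le_left _ _)
  have hlen : d - c ≤ 2 * δ := by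
    linarith [min_le_right b (x₀ + δ), le_max_right a (x₀ - δ)]
  have hne : intervalMeasure a b (Icc c d) ≠ ∞ := measure_ne_top _ _
  have hpos : intervalMeasure a b (Icc c d) ≠ 0 := by
    rw [Measure.restrict_apply measurableSet_Icc, inter_eq_self_of_subset_left hsub,
      Real.volume_Icc]
    exact (ENNReal.ofReal_pos.mpr (sub_pos.mpr hcd)).ne'
  have h1 := norm_opA_indicator_le α hk (abs_nonneg C)
    (fun x hx u hu => (hC x hx u hu).trans (le_abs_self C)) hx₀' hsub hne
  have h2 := hM (indicatorConstLp ∞ measurableSet_Icc hne (1 : ℂ))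
  rw [norm_indicatorConstLp_top hpos, norm_one] at h2
  have h3 : (1 : ℝ) ≤ D * (2 * δ) := by
    calc (1 : ℝ) ≤ _ := h2
      _ ≤ M * ((2 * (|a| + |b|) + |α| * |C|) * (2 * δ)) := by gcongr; exact h1.trans (by gcongr)
      _ = _ := by rw [hD]; ring
  have h4 : D * (2 * δ) ≤ 1 / 2 := by
    calc D * (2 * δ) ≤ (D + 1) * (2 * δ) := by gcongr; linarith
      _ = 1 / 2 := by rw [hδ]; field_simp; norm_num
  linarith

/-- Nearby `y` also give spectral points, so isolation would force `y² = x²` for every `y` in a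
nondegenerate interval. -/
theorem ne_neg_sqFun_of_isIsolatedPoint (hab : a < b) (α : ℝ) {k : ℝ → ℝ → ℂ}
    (hk : ContinuousOn (Function.uncurry k) (Icc a b ×ˢ Icc a b)) {lam : ℂ}
    (hlam : IsIsolatedPoint (spectrum ℂ (opA α hk)) lam) {x : ℝ} (hx : x ∈ Icc a b) :
    lam ≠ -sqFun x := by
  rintro rfl
  obtain ⟨-, δ, hδ, hiso⟩ := hlam
  have hc : Continuous fun y : ℝ => ‖-sqFun y - -sqFun x‖ := by
    unfold sqFun
    fun_prop
  have h1 : ∀ᶠ y in 𝓝 x, ‖-sqFun y - -sqFun x‖ < δ :=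
    hc.continuousAt.eventually (Iio_mem_nhds (by simpa using hδ))
  have h2 : ∀ᶠ y in 𝓝[Icc a b] x, y = x ∨ y = -x := by
    filter_upwards [nhdsWithin_le_nhds h1, self_mem_nhdsWithin] with y hy hyI
    have h3 := hiso _ (neg_sqFun_mem_spectrum hab α hk hyI) hy
    rw [neg_inj, sqFun, sqFun, Complex.ofReal_inj] at h3
    exact sq_eq_sq_iff_eq_or_eq_neg.mp h3
  rw [eventually_nhdsWithin_iff, Metric.eventually_nhds_iff] at h2
  obtain ⟨η, hη, h2⟩ := h2
  have hfin : (Metric.ball x η ∩ Icc a b).Finite := by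
    refine Set.Finite.subset (Set.toFinite {x, -x}) fun y hy => ?_
    exact h2 hy.1 hy.2
  have hcd : max a (x - η / 2) < min b (x + η / 2) :=
    max_lt (lt_min hab (by linarith [hx.1])) (lt_min (by linarith [hx.2]) (by linarith))
  refine (Icc_infinite hcd) (hfin.subset fun y hy => ⟨?_, ?_, ?_⟩)
  · rw [Metric.mem_ball, Real.dist_eq, abs_lt]
    constructor
    · linarith [(le_max_right a (x - η / 2)).trans hy.1]
    · linarith [hy.2.trans (min_le_right b (x + η / 2))]
  · exact (le_max_left _ _).trans hy.1
  · exact hy.2.trans (min_le_left _ _)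

/-- Off the values of `-x²`, the operator `A - λ` is a finite-rank perturbation of an invertible
operator. -/
theorem exists_isUnit_add_finiteRank (hab : a < b) (α : ℝ) {r : ℕ} (hr : 0 < r) {k : ℝ → ℝ → ℂ}
    (hk : ContDiffOn ℝ r (Function.uncurry k) (Icc a b ×ˢ Icc a b)) {lam : ℂ}
    (hlam : ∀ x ∈ Icc a b, lam ≠ -sqFun x) :
    ∃ S F : LInf a b →L[ℂ] LInf a b, IsUnit S ∧
      FiniteDimensional ℂ (LinearMap.range (F : LInf a b →ₗ[ℂ] LInf a b)) ∧
      S + F = opA α hk.continuousOn - algebraMap ℂ _ lam := by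
  have hm : MemLp (fun x => lam + sqFun x) ∞ (intervalMeasure a b) :=
    (memLp_const lam).add (sqFun_memLp a b)
  have hcont : Continuous fun x : ℝ => ‖lam + sqFun x‖ := by
    unfold sqFun
    fun_prop
  obtain ⟨x₁, hx₁, hmin⟩ := isCompact_Icc.exists_isMinOn (nonempty_Icc.mpr hab.le)
    hcont.continuousOn
  have hM : IsUnit (-multOp hm) := by
    refine (isUnit_multOp hm (c := ‖lam + sqFun x₁‖) ?_ ?_).neg
    · exact norm_pos_iff.mpr fun h => hlam x₁ hx₁ (eq_neg_of_add_eq_zero_left h)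
    · filter_upwards [ae_restrict_mem measurableSet_Icc] with x hx
      exact hmin hx
  -- Units are open, so a partition fine enough lets the error `α (K - KP)` be absorbed into the
  -- invertible part, leaving `α KP` as the finite-rank part.
  obtain ⟨η, hη, hball⟩ := Metric.isOpen_iff.mp Units.isOpen _ hM
  obtain ⟨C, hC⟩ := exists_norm_integralOp_sub_degKernel_le hab hr hk
  have hden : 0 < |α| * |C| + 1 := by positivity
  obtain ⟨P, hP⟩ := exists_partition_mesh_le hab (δ := η / 2 / (|α| * |C| + 1)) (by positivity)
  set K := integralOp (isBddKernel_of_continuousOn hk.continuousOn) with hK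
  have hfin := finiteDimensional_range_degKernel P r k
  set KP := integralOp (P.degKernel_isBddKernel r k) with hKP
  refine ⟨(α : ℂ) • (K - KP) + -multOp hm, (α : ℂ) • KP, hball ?_, ?_, ?_⟩
  · rw [mem_ball_iff_norm, add_sub_cancel_right, norm_smul, Complex.norm_real, Real.norm_eq_abs]
    have hPm := P.mesh_nonneg
    calc |α| * ‖K - KP‖ ≤ |α| * (|C| * P.mesh) := by
          gcongr
          exact (hC P).trans (by gcongr; exact le_abs_self C)
      _ = (|α| * |C|) * P.mesh := by ring
      _ ≤ (|α| * |C| + 1) * (η / 2 / (|α| * |C| + 1)) := by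
          gcongr
          linarith
      _ = η / 2 := mul_div_cancel₀ _ hden.ne'
      _ < η := half_lt_self hη
  · refine Submodule.finiteDimensional_of_le
      (S₂ := LinearMap.range (KP : LInf a b →ₗ[ℂ] LInf a b)) ?_
    rintro _ ⟨f, rfl⟩
    exact Submodule.smul_mem _ _ ⟨f, rfl⟩
  · rw [← algebraMap_add_multOp (sqFun_memLp a b) lam hm, opA, smul_sub]
    abel

/-! ### Simple eigenvalues -/

theorem mem_kerPow_one {T : LInf a b →L[ℂ] LInf a b} {z : ℂ} {f : LInf a b} :
    f ∈ kerPow T z 1 ↔ (T - algebraMap ℂ _ z) f = 0 := by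
  rw [kerPow, pow_one, LinearMap.mem_ker]
  rfl

theorem mem_kerPow_two {T : LInf a b →L[ℂ] LInf a b} {z : ℂ} {f : LInf a b} :
    f ∈ kerPow T z (1 + 1) ↔ (T - algebraMap ℂ _ z) ((T - algebraMap ℂ _ z) f) = 0 := by
  rw [kerPow, one_add_one_eq_two, pow_two, LinearMap.mem_ker]
  rfl

theorem kerPow_mono (T : LInf a b →L[ℂ] LInf a b) (z : ℂ) {l m : ℕ} (h : l ≤ m) :
    kerPow T z l ≤ kerPow T z m := by
  intro f hf
  rw [kerPow, LinearMap.mem_ker] at hf ⊢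
  obtain ⟨c, rfl⟩ := Nat.exists_eq_add_of_le' h
  rw [pow_add, Module.End.mul_apply, hf, map_zero]

/-- A simple eigenvalue has ascent one and a one-dimensional eigenspace. -/
theorem IsSimpleEigenvalue.exists_eigenvector {T : LInf a b →L[ℂ] LInf a b} {z : ℂ}
    (h : IsSimpleEigenvalue T z) :
    ∃ v : LInf a b, v ≠ 0 ∧ (T - algebraMap ℂ _ z) v = 0 ∧
      (∀ x, (T - algebraMap ℂ _ z) x = 0 → ∃ c : ℂ, x = c • v) ∧
      ∀ x, (T - algebraMap ℂ _ z) ((T - algebraMap ℂ _ z) x) = 0 →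
        (T - algebraMap ℂ _ z) x = 0 := by
  obtain ⟨hev, l, ⟨⟨hl0, hl⟩, hmin⟩, hdim⟩ := h
  obtain ⟨v, hv⟩ := hev.exists_hasEigenvector
  have hv1 : v ∈ kerPow T z 1 := by
    rw [mem_kerPow_one, sub_apply, Algebra.algebraMap_eq_smul_one, smul_apply, one_apply_eq_self]
    exact sub_eq_zero.mpr hv.apply_eq_smul
  have hspan : ∀ x ∈ kerPow T z l, ∃ c : ℂ, x = c • v := by
    intro x hx
    have hvl : v ∈ kerPow T z l := kerPow_mono T z hl0 hv1
    obtain ⟨c, hc⟩ := (finrank_eq_one_iff_of_nonzero' (⟨v, hvl⟩ : kerPow T z l)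
      (fun h => hv.2 (congrArg Subtype.val h))).mp hdim ⟨x, hx⟩
    exact ⟨c, (congrArg Subtype.val hc).symm⟩
  have hle : kerPow T z l ≤ kerPow T z 1 := by
    intro x hx
    obtain ⟨c, rfl⟩ := hspan x hx
    exact Submodule.smul_mem _ c hv1
  -- The kernel of the `l`-th power is already the first kernel, so the increasing chain of kernels
  -- is stationary from 1 on.
  have hl1 : l = 1 := by
    by_contra hne
    have h2 : 2 ≤ l := by omega
    have h3 : l ≤ 1 := hmin ⟨one_pos, le_antisymm (kerPow_mono T z (Nat.le_succ 1))
      ((kerPow_mono T z h2).trans hle)⟩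
    omega
  subst hl1
  refine ⟨v, hv.2, mem_kerPow_one.mp hv1, fun x hx => hspan x (mem_kerPow_one.mpr hx),
    fun x hx => ?_⟩
  rw [← mem_kerPow_two, ← hl] at hx
  exact mem_kerPow_one.mp hx

/-! ### Isolated points of the spectrum -/

/-- The extended distance is `∞` when `lam` is the only point of `S`, so then every `ε` is
admissible. -/
theorem notMem_of_ofReal_lt_infEDist {S : Set ℂ} {lam : ℂ} {ε : ℝ}
    (h : ENNReal.ofReal ε < Metric.infEDist lam (S \ {lam})) {z : ℂ} (hz : ‖z - lam‖ ≤ ε)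
    (hne : z ≠ lam) : z ∉ S := by
  intro hzS
  have h1 : Metric.infEDist lam (S \ {lam}) ≤ edist lam z :=
    Metric.infEDist_le_edist_of_mem ⟨hzS, hne⟩
  have h2 : edist lam z ≤ ENNReal.ofReal ε := by
    rw [edist_dist, dist_comm, dist_eq_norm]
    exact ENNReal.ofReal_le_ofReal hz
  exact absurd (h1.trans h2) (not_le.mpr h)

/-- The spectral points of nearby elements within distance `ε` of an isolated point of the spectrum
are close to that point. -/
theorem eventually_norm_sub_lt {R : Type*} [NormedRing R] [NormedAlgebra ℂ R] [CompleteSpace R]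
    {x : R} {lam : ℂ} {ε δ : ℝ} (hδ : 0 < δ)
    (h : ENNReal.ofReal ε < Metric.infEDist lam (spectrum ℂ x \ {lam})) :
    ∀ᶠ y in 𝓝 x, ∀ z ∈ spectrum ℂ y, ‖z - lam‖ < ε → ‖z - lam‖ < δ := by
  -- On this compact annulus there is no spectrum of `x`, hence none of nearby `y`.
  have hK : IsCompact (Metric.closedBall lam ε \ Metric.ball lam δ) :=
    (isCompact_closedBall lam ε).diff Metric.isOpen_ball
  have hd : ∀ z ∈ Metric.closedBall lam ε \ Metric.ball lam δ, z ∉ spectrum ℂ x := by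
    rintro z ⟨hz, hz'⟩
    refine notMem_of_ofReal_lt_infEDist h (mem_closedBall_iff_norm.mp hz) ?_
    rintro rfl
    exact hz' (Metric.mem_ball_self hδ)
  filter_upwards [eventually_disjoint_spectrum hK hd] with y hy z hz hzε
  by_contra hcon
  exact hy z ⟨mem_closedBall_iff_norm.mpr hzε.le, fun hb => hcon (mem_ball_iff_norm.mp hb)⟩ hz

theorem tendsto_opApprox (hab : a < b) (α : ℝ) {r : ℕ} (hr : 0 < r) {k : ℝ → ℝ → ℂ}
    (hk : ContDiffOn ℝ r (Function.uncurry k) (Icc a b ×ˢ Icc a b)) {P : ℕ → Partition a b}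
    (hP : Tendsto (fun m => (P m).mesh) atTop (𝓝 0)) :
    Tendsto (fun m => opApprox α k r (P m)) atTop (𝓝 (opA α hk.continuousOn)) := by
  obtain ⟨C, hC⟩ := exists_norm_opA_sub_opApprox_le hab α hr hk
  rw [tendsto_iff_norm_sub_tendsto_zero]
  refine squeeze_zero (fun _ => norm_nonneg _) (fun m => ?_) (by simpa using hP.const_mul C)
  rw [norm_sub_rev]
  exact hC (P m)

/-- The abstract estimate for `T = A - λ`, `B = A_{N_h} - λ` and the eigenvalue `z - λ` of `B`. Its
constants do not involve the partition. -/
theorem exists_rate_of_isSimpleEigenvalue (hab : a < b) (α : ℝ) {r : ℕ} (hr : 0 < r)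
    {k : ℝ → ℝ → ℂ} (hk : ContDiffOn ℝ r (Function.uncurry k) (Icc a b ×ˢ Icc a b)) {lam : ℂ}
    (hlam : IsIsolatedPoint (spectrum ℂ (opA α hk.continuousOn)) lam)
    (hsimple : IsSimpleEigenvalue (opA α hk.continuousOn) lam) :
    ∃ c δ : ℝ, 0 < δ ∧ 0 ≤ c ∧ ∀ P : Partition a b, ∀ z ∈ spectrum ℂ (opApprox α k r P),
      ‖z - lam‖ < δ → ‖opApprox α k r P - opA α hk.continuousOn‖ < δ →
      ‖z - lam‖ ≤ c * ‖opApprox α k r P - opA α hk.continuousOn‖ := by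
  obtain ⟨S, F, hS, hF, hSF⟩ := exists_isUnit_add_finiteRank hab α hr hk
    fun x hx => ne_neg_sqFun_of_isIsolatedPoint hab α hk.continuousOn hlam hx
  obtain ⟨v, hv, hTv, hker, hker2⟩ := hsimple.exists_eigenvector
  rw [← hSF] at hTv hker hker2
  obtain ⟨c, δ, hδ, hc, h⟩ := exists_norm_eigenvalue_le hS hF hv hTv hker hker2
  refine ⟨c, δ, hδ, hc, fun P z hz hzδ hPδ => ?_⟩
  obtain ⟨f, hf0, hf⟩ := exists_eigenfunction_opApprox α k r P hz
  have hfn : ‖f‖ ≠ 0 := norm_ne_zero_iff.mpr hf0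
  have hdiff : opApprox α k r P - algebraMap ℂ _ lam - (S + F) =
      opApprox α k r P - opA α hk.continuousOn := by
    rw [hSF]
    abel
  rw [← hdiff] at hPδ ⊢
  refine h _ (z - lam) ((‖f‖⁻¹ : ℂ) • f) ?_ ?_ hzδ hPδ
  · rw [norm_smul, norm_inv, Complex.norm_real, norm_norm, inv_mul_cancel₀ hfn]
  · rw [map_smul, sub_apply, Algebra.algebraMap_eq_smul_one, smul_apply, one_apply_eq_self, hf,
      ← sub_smul, smul_comm]

end DegenerateKernel

open DegenerateKernel in
theorem mainTheorem1 (a b : ℝ) (hab : a < b) (α : ℝ) (r : ℕ) (hr : 0 < r) (k : ℝ → ℝ → ℂ)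
    (hk : ContDiffOn ℝ r (Function.uncurry k) (Icc a b ×ˢ Icc a b)) :
    -- the operators converge in norm with rate `O(h)`
    (∃ C : ℝ, ∀ P : Partition a b,
      ‖opA α hk.continuousOn - opApprox α k r P‖ ≤ C * P.mesh) ∧
    -- convergence of the approximate eigenvalues to each isolated point of the spectrum
    (∀ lam : ℂ, IsIsolatedPoint (spectrum ℂ (opA α hk.continuousOn)) lam →
      ∀ P : ℕ → Partition a b, Tendsto (fun m => (P m).mesh) atTop (𝓝 0) →
      ∀ ε : ℝ, 0 < ε →
        ENNReal.ofReal ε < Metric.infEDist lam (spectrum ℂ (opA α hk.continuousOn) \ {lam}) →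
        (∀ᶠ m in atTop, ∃ z : ℂ, IsEigenvalue (opApprox α k r (P m)) z ∧ ‖z - lam‖ < ε) ∧
        (∀ z : ℕ → ℂ,
          (∀ᶠ m in atTop, z m ∈ spectrum ℂ (opApprox α k r (P m)) ∧ ‖z m - lam‖ < ε) →
          Tendsto z atTop (𝓝 lam))) ∧
    -- the rate of convergence for simple eigenvalues
    (∀ lam : ℂ, IsIsolatedPoint (spectrum ℂ (opA α hk.continuousOn)) lam →
      IsSimpleEigenvalue (opA α hk.continuousOn) lam →
      ∃ c C : ℝ, ∀ P : ℕ → Partition a b, Tendsto (fun m => (P m).mesh) atTop (𝓝 0) →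
      ∀ ε : ℝ, 0 < ε →
        ENNReal.ofReal ε < Metric.infEDist lam (spectrum ℂ (opA α hk.continuousOn) \ {lam}) →
        ∀ᶠ m in atTop, ∀ z ∈ spectrum ℂ (opApprox α k r (P m)), ‖z - lam‖ < ε →
          ‖z - lam‖ ≤ c * ‖opApprox α k r (P m) - opA α hk.continuousOn‖ ∧
          ‖z - lam‖ ≤ C * (P m).mesh) := by
  refine ⟨exists_norm_opA_sub_opApprox_le hab α hr hk, ?_, ?_⟩
  · intro lam hlam P hP ε hε hdist
    have hlim := tendsto_opApprox hab α hr hk hP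
    refine ⟨?_, fun z hz => ?_⟩
    · have hd : ∀ w ∈ Metric.sphere lam ε, w ∉ spectrum ℂ (opA α hk.continuousOn) := by
        intro w hw
        refine notMem_of_ofReal_lt_infEDist hdist (mem_sphere_iff_norm.mp hw).le ?_
        rintro rfl
        rw [mem_sphere_iff_norm, sub_self, norm_zero] at hw
        exact hε.ne hw
      filter_upwards [hlim.eventually (eventually_exists_mem_spectrum hlam.1 hε hd)]
        with m ⟨w, hw, hwε⟩
      exact ⟨w, isEigenvalue_of_mem_spectrum_opApprox α k r (P m) hw, hwε⟩
    · rw [Metric.tendsto_nhds]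
      intro δ hδ
      filter_upwards [hz, hlim.eventually (eventually_norm_sub_lt hδ hdist)] with m h1 h2
      rw [dist_eq_norm]
      exact h2 _ h1.1 h1.2
  · intro lam hlam hsimple
    obtain ⟨C, hC⟩ := exists_norm_opA_sub_opApprox_le hab α hr hk
    obtain ⟨c, δ, hδ, hc, h⟩ := exists_rate_of_isSimpleEigenvalue hab α hr hk hlam hsimple
    refine ⟨c, c * C, fun P hP ε hε hdist => ?_⟩
    have hlim := tendsto_opApprox hab α hr hk hP
    -- The linear estimate holds only within the radius `δ` belonging to `λ`; points within `ε` are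
    -- eventually within `δ`, so the constants do not depend on `ε`.
    filter_upwards [hlim.eventually (eventually_norm_sub_lt hδ hdist),
      (tendsto_iff_norm_sub_tendsto_zero.mp hlim).eventually (Iio_mem_nhds hδ)] with m h1 h2 z hz hzε
    have h3 := h (P m) z hz (h1 z hz hzε) h2
    refine ⟨h3, h3.trans ?_⟩
    rw [mul_assoc, norm_sub_rev]
    exact mul_le_mul_of_nonneg_left (hC (P m)) hc
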